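/- **Setting.** Fix $\alpha\in(0,1)$ and let $\mathbb N=\{1,2,\dots\}$. PPP($\alpha$) is the law of the sequence $\xi_i=x_i^{-1/\alpha}$, where $0\le x_1\le x_2\le\cdots$ are the points of a Poisson process of intensity $1$ on $[0,\infty)$; one has $S=\sum_i\xi_i<\infty$ a.s. PD($\alpha$) is the law of $(\xi_i/S)_{i\ge1}$. Let $V$ be the set of finite words over $\mathbb N$ (with root $\varnothing$), let $\xi^{(\mathbf k)}$, $\mathbf k\in V$, be independent sequences with law PPP($\alpha$), and let $S_{\mathbf k}=\sum_i\xi^{(\mathbf k)}_i$. For $\mathbf k=\mathbf v i$ put $$\hat\zeta^{(\mathbf k)}_j=\frac{\xi^{(\mathbf k)}_j}{\xi^{(\mathbf v)}_i+S_{\mathbf k}},\qquad \hat\omega^{(\mathbf k)}_j=\frac{\xi^{(\mathbf k)}_j}{\xi^{(\mathbf k)}_j+S_{\mathbf kj}},$$ where $\xi^{(\mathbf v)}_i$ is replaced by $0$ (and $\hat\omega^{(\varnothing)}_j$ is defined by the same formula) if $\mathbf k=\varnothing$. The tree $\hat{\mathcal T}_+$ has weight $\hat\zeta^{(\mathbf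 k)}_j$ on the edge $\{\mathbf k,\mathbf kj\}$ if $\mathbf k$ has even length and $\hat\omega^{(\mathbf k)}_j$ if it has odd length; for $\hat{\mathcal T}_-$ even and odd are exchanged. For $z\in\mathbb C$, $\hat{\mathcal T}_\pm(z)$ is obtained from $\hat{\mathcal T}_\pm$ as follows. Say that the root has type $\pm$ and that types alternate along the generations (so that the ordinary edges from a vertex to its children carry $\hat\zeta$ weights at type $+$ and $\hat\omega$ weights at type $-$). To each vertex attach one additional child, by an edge of weight $-z$ if the vertex has type $+$ and $-\bar z$ if it has type $-$ (the reversed edge has the conjugate weight). At each additional child, which has the type $s\in\{+,-\}$ opposite to that of its parent, root an independent copy of $\hat{\mathcal T}_s$. Repeat the procedure with all the new vertices other than the additional children themselves, and so on. Let $\bar{\mathcal T}_\pm(z)$ be the connected component of the root after removal of the edge between the root of $\hat{\mathcal T}_\pm(z)$ and its additional child. These weighted trees are identified with the closures of their adjacency operators, defined on finitely supported vectors in $\ell^2$ of the vertex set. For $\eta$ with $\operatorname{Im}\eta>0$ put $$h^{(\pm)}(\eta,z)=\langle\delta_\varnothing,(\hat{\mathcal T}_\pm(z)-\eta)^{-1}\delta_\varnothing\rangle,\qquad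 \bar h^{(\pm)}(\eta,z)=\langle\delta_\varnothing,(\bar{\mathcal T}_\pm(z)-\eta)^{-1}\delta_\varnothing\rangle .$$ **Proposition.** Let $\operatorname{Im}\eta>0$, $z\in\mathbb C$, and write $h^{(\pm)}=h^{(\pm)}(\eta,z)$, $\bar h^{(\pm)}=\bar h^{(\pm)}(\eta,z)$, $\psi(x)=-(\eta+x)^{-1}$. Almost surely the operators above are self-adjoint, so that these random variables are well defined, and the following equalities in distribution hold (almost surely, all series below converge and the denominators $1-|z|^2(\cdots)$ in 1 and 4 are nonzero). 1. If $\bar h^{(-)},\bar h^{(+)}$ are taken independent, then $$h^{(-)}\overset d=\frac{\bar h^{(-)}}{1-|z|^2\bar h^{(-)}\bar h^{(+)}},\qquad h^{(+)}\overset d=\frac{\bar h^{(+)}}{1-|z|^2\bar h^{(-)}\bar h^{(+)}}.$$ 2. $$\bar h^{(+)}\overset d=\psi\Big(\sum_{k\ge1}\zeta_k^2h_k^{(-)}\Big).$$ 3. $$\bar h^{(-)}\overset d=\psi\Big(\sum_{k\ge1}\big(\tfrac{\xi_k}{\xi_k+S_k}\big)^2\,\psi\Big(|z|^2\bar h_k^{(-)}+\sum_{j\ge1}\big(\tfrac{\xi^{(k)}_j}{\xi_k+S_k}\big)^2h_{k,j}^{(-)}\Big)\Big),\qquad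 S_k=\sum_{j\ge1}\xi^{(k)}_j.$$ 4. $$h^{(-)}\overset d=\frac{\bar h^{(-)}}{1-|z|^2\,\bar h^{(-)}\,\psi\big(\sum_{k\ge1}\zeta_k^2h_k^{(-)}\big)}.$$ 5. If $z=0$, then $\bar h^{(\pm)}=h^{(\pm)}$ almost surely, and $$h^{(-)}\overset d=\psi\Big(\sum_{k\ge1}\big(\tfrac{\xi_k}{\xi_k+S_k}\big)^2\,\psi\Big(\sum_{j\ge1}\big(\tfrac{\xi^{(k)}_j}{\xi_k+S_k}\big)^2h_{k,j}^{(-)}\Big)\Big),\qquad h^{(+)}\overset d=\psi\Big(\sum_{k\ge1}\zeta_k^2h_k^{(-)}\Big).$$ Here, on the right-hand sides, $h^{(-)}_k$ and $h^{(-)}_{k,j}$ are i.i.d. copies of $h^{(-)}$; $\bar h^{(-)}_k$ are i.i.d. copies of $\bar h^{(-)}$ (and $\bar h^{(-)}$ in 4 is one such copy); $(\xi_k)_k$ and $(\xi^{(k)}_j)_j$, $k\in\mathbb N$, are independent sequences with law PPP($\alpha$); $(\zeta_k)_k$ has law PD($\alpha$); and all the variables and sequences that occur on one right-hand side are mutually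 independent. -/

import Mathlib

open MeasureTheory ProbabilityTheory
open scoped ENNReal ComplexConjugate

noncomputable section

namespace AltTree

/-! ### The laws PPP(α) and PD(α)

Sequences are indexed by `ℕ` from `0`, so the `n`-th point here is the point number `n + 1` of the
usual enumeration by positive integers. -/

/-- From waiting times `E` to the ranked points `ξ n = (E 0 + ⋯ + E n) ^ (-1/α)`. -/
def rankedPoints (α : ℝ) (E : ℕ → ℝ) (n : ℕ) : ℝ :=
  (∑ i ∈ Finset.range (n + 1), E i) ^ (-1 / α)

/-- The law PPP(α) of the decreasingly ranked points of the Poisson point process on `(0, ∞)` with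
intensity `α t ^ (-α - 1)`: the law of `x_n ^ (-1/α)`, where `x_0 ≤ x_1 ≤ ⋯` are the arrival times
of the Poisson process of rate `1` on the half-line (partial sums of i.i.d. standard exponential
waiting times). -/
def pppLaw (α : ℝ) : Measure (ℕ → ℝ) :=
  (Measure.infinitePi fun _ : ℕ => expMeasure 1).map (rankedPoints α)

/-- The law PD(α): the law of `(ξ_k / ∑ j, ξ_j)_k` where `ξ` has law PPP(α). -/
def pdLaw (α : ℝ) : Measure (ℕ → ℝ) :=
  (pppLaw α).map fun x k => x k / ∑' j, x j

lemma measurable_rankedPoints (α : ℝ) : Measurable (rankedPoints α) := by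
  refine measurable_pi_lambda _ fun n => ?_
  unfold rankedPoints
  fun_prop

instance isProbabilityMeasure_pppLaw (α : ℝ) : IsProbabilityMeasure (pppLaw α) := by
  have : IsProbabilityMeasure (expMeasure 1) := isProbabilityMeasure_expMeasure one_pos
  exact Measure.isProbabilityMeasure_map (measurable_rankedPoints α).aemeasurable

lemma measurable_normalize : Measurable fun (x : ℕ → ℝ) (k : ℕ) => x k / ∑' j, x j :=
  measurable_pi_lambda _ fun k =>
    (measurable_pi_apply k).div (Measurable.tsum fun j => measurable_pi_apply j)

instance isProbabilityMeasure_pdLaw (α : ℝ) : IsProbabilityMeasure (pdLaw α) :=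
  Measure.isProbabilityMeasure_map measurable_normalize.aemeasurable

/-! ### Adjacency operators of weighted graphs and their resolvents -/

/-- The adjacency operator in `ℓ²(V)` of the Hermitian weights `w`, on finitely supported vectors:
`(A φ)(u) = ∑ v, w u v * φ v`. Its domain consists of the finitely supported `φ` with `A φ ∈ ℓ²(V)`,
hence of all finitely supported vectors as soon as all columns `w · v` are square summable. -/
def adjacency {V : Type*} (w : V → V → ℂ) :
    lp (fun _ : V => ℂ) 2 →ₗ.[ℂ] lp (fun _ : V => ℂ) 2 where
  domain :=
    { carrier := {φ | (Function.support (φ : V → ℂ)).Finite ∧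
        Memℓp (fun u : V => ∑ᶠ v, w u v * φ v) 2}
      zero_mem' := by
        refine ⟨by simp [Function.support], ?_⟩
        simpa using (zero_mem_ℓp' : Memℓp (fun _ : V => (0 : ℂ)) 2)
      add_mem' := by
        rintro φ χ ⟨hφ, hφ'⟩ ⟨hχ, hχ'⟩
        refine ⟨(hφ.union hχ).subset (Function.support_add _ _), ?_⟩
        convert hφ'.add hχ' using 1
        funext u
        simp only [lp.coeFn_add, Pi.add_apply, mul_add]
        exact finsum_add_distrib (hφ.subset (Function.support_mul_subset_right _ _))
          (hχ.subset (Function.support_mul_subset_right _ _))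
      smul_mem' := by
        rintro c φ ⟨hφ, hφ'⟩
        refine ⟨hφ.subset (Function.support_const_smul_subset c _), ?_⟩
        convert hφ'.const_smul c using 1
        funext u
        simp only [lp.coeFn_smul, Pi.smul_apply, smul_eq_mul]
        refine Eq.trans (finsum_congr fun v => ?_) (mul_finsum (fun v => w u v * φ v) c).symm
        exact mul_left_comm _ _ _ }
  toFun :=
    { toFun := fun φ => ⟨fun u => ∑ᶠ v, w u v * φ.1 v, φ.2.2⟩
      map_add' := by
        rintro ⟨φ, hφ, hφ'⟩ ⟨χ, hχ, hχ'⟩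
        ext u
        simp only [Submodule.coe_add, lp.coeFn_add, Pi.add_apply, mul_add]
        exact finsum_add_distrib (hφ.subset (Function.support_mul_subset_right _ _))
          (hχ.subset (Function.support_mul_subset_right _ _))
      map_smul' := by
        rintro c ⟨φ, hφ, hφ'⟩
        ext u
        simp only [lp.coeFn_smul, Pi.smul_apply, smul_eq_mul, RingHom.id_apply]
        refine Eq.trans (finsum_congr fun v => ?_) (mul_finsum (fun v => w u v * φ v) c).symm
        exact mul_left_comm _ _ _ }

/-- The adjacency operator is defined on all finitely supported vectors (the columns are square
summable) and its closure is a self-adjoint operator. -/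
def IsSelfAdjointAdjacency {V : Type*} (w : V → V → ℂ) : Prop :=
  (∀ v, Memℓp (fun u => w u v) 2) ∧ IsSelfAdjoint (adjacency w).closure

open scoped Classical in
/-- The entry `⟨e, (A - η)⁻¹ e⟩` of the resolvent of a (possibly unbounded) operator `A`;
the value is `0` if `e` is not in the range of `A - η`. -/
def resolventEntry {H : Type*} [NormedAddCommGroup H] [InnerProductSpace ℂ H]
    (A : H →ₗ.[ℂ] H) (η : ℂ) (e : H) : ℂ :=
  let R : H →ₗ.[ℂ] H := ((-η) • (LinearMap.id : H →ₗ[ℂ] H) +ᵥ A).inverse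
  if he : e ∈ R.domain then inner ℂ e (R ⟨e, he⟩) else 0

open scoped Classical in
/-- The resolvent entry at `o` of the closure of the adjacency operator with weights `w`. -/
def rootResolvent {V : Type*} (w : V → V → ℂ) (o : V) (η : ℂ) : ℂ :=
  resolventEntry (adjacency w).closure η (lp.single 2 o 1)

/-! ### The alternate Poisson weighted trees

A vertex is the word of the edge labels on the path from the root to it, *the last label first*:
the child of `k` with label `a` is `a :: k`, the root is `[]`, the parent of `a :: k` is `k`. The
label `some j` is that of the `j`-th ordinary child, the label `none` that of the additional child
(pending node) attached by an edge of weight `-z` or `-conj z`, at which an independent copy of the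
tree without parameter `z` is rooted. A pending node gets no additional child. -/

/-- Words in the labels `some j` (ordinary children) and `none` (the additional child). -/
abbrev Word : Type := List (Option ℕ)

/-- Vertices of the tree with parameter `z`: no additional child of an additional child. -/
def vertices : Set Word := {k | k.IsChain fun a b => ¬(a = none ∧ b = none)}

/-- Vertices of the connected component of the root after removal of the edge from the root to its
additional child (the first edge label is the last entry of the word). -/
def barVertices : Set Word := {k | k ∈ vertices ∧ k.getLast? ≠ some none}

lemma nil_mem_vertices : ([] : Word) ∈ vertices := by simp [vertices]

lemma nil_mem_barVertices : ([] : Word) ∈ barVertices := by simp [barVertices, nil_mem_vertices]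

/-- Type (`true` for `+`, `false` for `-`) of a vertex of the tree whose root has type `s`: types
alternate along the generations. -/
def kind (s : Bool) : Word → Bool
  | [] => s
  | _ :: k => !(kind s k)

/-- The point `ξ^{(v)}_i` if the word is the ordinary child `v i` of `v`; it is `0` for the root and
for an additional child, since the latter is the root of a new copy of the tree. -/
def parentPoint (x : Word → ℕ → ℝ) : Word → ℝ
  | some i :: v => x v i
  | _ => 0

/-- `ζ̂^{(k)}_j = ξ^{(k)}_j / (ξ^{(v)}_i + S_k)` where `k = v i`. -/
def zetaHat (x : Word → ℕ → ℝ) (k : Word) (j : ℕ) : ℝ :=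
  x k j / (parentPoint x k + ∑' i, x k i)

/-- `ω̂^{(k)}_j = ξ^{(k)}_j / (ξ^{(k)}_j + S_{kj})`. -/
def omegaHat (x : Word → ℕ → ℝ) (k : Word) (j : ℕ) : ℝ :=
  x k j / (x k j + ∑' i, x (some j :: k) i)

/-- Weight of the directed edge from `k` to its child with label `a`, in the tree with root of type
`s`. -/
def edgeWeight (s : Bool) (z : ℂ) (x : Word → ℕ → ℝ) (k : Word) : Option ℕ → ℂ
  | some j => if kind s k then (zetaHat x k j : ℂ) else (omegaHat x k j : ℂ)
  | none => if kind s k then -z else -conj z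

/-- Hermitian weights: the weight of `(a :: k, k)` is the conjugate of that of `(k, a :: k)`, and
the weight is `0` for pairs of words that are not parent and child. -/
def treeWeight (s : Bool) (z : ℂ) (x : Word → ℕ → ℝ) (u v : Word) : ℂ :=
  (match v with
    | a :: k => if k = u then edgeWeight s z x u a else 0
    | [] => 0) +
  (match u with
    | a :: k => if k = v then conj (edgeWeight s z x v a) else 0
    | [] => 0)

/-- Weights of the tree `T̂_s(z)` with points `x`. -/
def hatTree (s : Bool) (z : ℂ) (x : Word → ℕ → ℝ) (u v : vertices) : ℂ :=
  treeWeight s z x u v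

/-- Weights of the tree `T̄_s(z)` with points `x`. -/
def barTree (s : Bool) (z : ℂ) (x : Word → ℕ → ℝ) (u v : barVertices) : ℂ :=
  treeWeight s z x u v

/-- `h^{(s)}(η, z)` as a function of the points. -/
def hRes (s : Bool) (η z : ℂ) (x : Word → ℕ → ℝ) : ℂ :=
  rootResolvent (hatTree s z x) ⟨[], nil_mem_vertices⟩ η

/-- `h̄^{(s)}(η, z)` as a function of the points. -/
def hBar (s : Bool) (η z : ℂ) (x : Word → ℕ → ℝ) : ℂ :=
  rootResolvent (barTree s z x) ⟨[], nil_mem_barVertices⟩ η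

/-- The points used to build the trees: independent sequences with law PPP(α), one per vertex. -/
structure IsPoissonField {Ω : Type*} [MeasurableSpace Ω] (α : ℝ) (ξ : Word → Ω → ℕ → ℝ)
    (P : Measure Ω) : Prop where
  indep : iIndepFun ξ P
  hasLaw : ∀ k, HasLaw (ξ k) (pppLaw α) P

/-- `X i`, `i : ι`, are i.i.d. copies of `Y`. -/
structure IsIIDCopies {ι Ω Ω' E : Type*} [MeasurableSpace Ω] [MeasurableSpace Ω']
    [MeasurableSpace E] (X : ι → Ω' → E) (P' : Measure Ω') (Y : Ω → E) (P : Measure Ω) :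
    Prop where
  indep : iIndepFun X P'
  identDistrib : ∀ i, IdentDistrib (X i) Y P' P

/-- `ψ(x) = -(η + x)⁻¹`. -/
def psi (η x : ℂ) : ℂ := -(η + x)⁻¹

/-- `ξ_k / (ξ_k + S_k)` where `S_k = ∑ j, ξ^{(k)}_j`. -/
def outerWeight (x : ℕ → ℝ) (y : ℕ → ℕ → ℝ) (k : ℕ) : ℝ := x k / (x k + ∑' i, y k i)

/-- `ξ^{(k)}_j / (ξ_k + S_k)` where `S_k = ∑ j, ξ^{(k)}_j`. -/
def innerWeight (x : ℕ → ℝ) (y : ℕ → ℕ → ℝ) (k j : ℕ) : ℝ := y k j / (x k + ∑' i, y k i)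

end AltTree

end

/-! The identities in law come from pathwise identities between resolvent entries, valid for every
regular configuration of points, combined with the independence of disjoint blocks of coordinates.

Self-adjointness. Hermitian weights with square summable columns have the maximal operator as
adjoint, so the closure is self-adjoint once `w φ = c φ` has no nonzero ℓ² solution for nonreal `c`
(`IsDeterminate`). On a tree this follows if the edge terms `conj (φ k) * e k a * φ (a :: k)` are
absolutely summable: pairing the equation with `φ` then gives a real number on one side and `c ‖φ‖²`
on the other. The ζ̂ edges and the edges of weight `-z`, `-conj z` have square sums bounded
uniformly over the vertices, and Cauchy–Schwarz handles them. The square sums of the ω̂ edges are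
finite but not uniformly bounded; however, an ω̂ edge leads to a vertex all of whose edges to
children are of the first kind, and the equation at that vertex expresses the ω̂ term through
summable ones (`IsTame.summable_edgeTerm`). Almost sure finiteness of the sums of ω̂² uses the decay
of the ranked points and the finite mean of the inverse of the largest point (`ae_isRegular`).

Recursion. Restricted to the subtree at a child, the solution of `(w - η) φ = δ` at the root solves
the same equation with a source proportional to the value at the root. This gives the Schur
complement formula `IsTame.treeRes_eq`. A subtree is again an alternate tree, except that a root of
type + remembers the point of the edge above it; a root of type - does not use that point. Hence one
application of the formula closes the recursion for type +, two are needed for type -, and comparing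
the trees with and without the additional child of the root gives the quotient
`IsRegular.hRes_eq_div`.

Laws. The resolvent entries are almost everywhere measurable (`aemeasurable_rootResolvent`), the
points of different subtrees are independent blocks of a product measure, and each right-hand side
is a measurable function of such blocks. Any family with the prescribed marginals and independence
has the same joint law (`identDistrib_plusTuple`, `identDistrib_minusTuple`), so the pathwise
identities become identities in distribution. -/

noncomputable section

namespace AltTree

section

/-! ### Hermitian matrices with square summable columns -/

section Determinate

variable {V : Type*} {w : V → V → ℂ}

/-- Hermitian weights with square summable columns for which the equation `w φ = c φ` has no
nonzero square summable solution if `c` is not real. -/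
structure IsDeterminate (w : V → V → ℂ) : Prop where
  herm : ∀ u v, w v u = conj (w u v)
  col : ∀ v, Memℓp (fun u => w u v) 2
  eq_zero : ∀ c : ℂ, c.im ≠ 0 → ∀ φ : lp (fun _ : V => ℂ) 2,
    (∀ u, ∑' v, w u v * φ v = c * φ u) → φ = 0

/-- By Hermitian symmetry a row is a conjugated column, hence square summable, and the series is an
inner product in ℓ². -/
lemma hasSum_row (herm : ∀ u v, w v u = conj (w u v)) (col : ∀ v, Memℓp (fun u => w u v) 2)
    (u : V) (φ : lp (fun _ : V => ℂ) 2) :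
    HasSum (fun v => w u v * φ v) (inner ℂ (⟨fun v => w v u, col u⟩ : lp (fun _ : V => ℂ) 2) φ) := by
  refine (lp.hasSum_inner (𝕜 := ℂ) (⟨fun v => w v u, col u⟩ : lp (fun _ : V => ℂ) 2)
    φ).congr_fun ?_
  intro v
  simp [herm u v, mul_comm]

open scoped Classical in
lemma single_apply_eq_ite (v : V) (c : ℂ) (u : V) :
    (lp.single 2 v c : lp (fun _ : V => ℂ) 2) u = if u = v then c else 0 := by
  split_ifs with h
  · subst h
    exact lp.single_apply_self (E := fun _ : V => ℂ) 2 u c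
  · exact lp.single_apply_ne (E := fun _ : V => ℂ) 2 v c h

open scoped Classical in
lemma finsum_mul_single (f : V → ℂ) (v : V) (c : ℂ) :
    ∑ᶠ x, f x * (lp.single 2 v c : lp (fun _ : V => ℂ) 2) x = f v * c := by
  rw [finsum_eq_single _ v fun x hx => by rw [single_apply_eq_ite, if_neg hx, mul_zero],
    single_apply_eq_ite, if_pos rfl]

open scoped Classical in
lemma single_mem_domain (col : ∀ v, Memℓp (fun u => w u v) 2) (v : V) (c : ℂ) :
    (lp.single 2 v c : lp (fun _ : V => ℂ) 2) ∈ (adjacency w).domain := by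
  refine ⟨(Set.finite_singleton v).subset fun u hu => ?_, ?_⟩
  · by_contra h
    exact hu ((single_apply_eq_ite v c u).trans (if_neg h))
  · convert (col v).const_smul c using 1
    funext u
    rw [finsum_mul_single]
    simp [mul_comm]

lemma adjacency_apply (φ : (adjacency w).domain) (u : V) :
    (adjacency w φ : lp (fun _ : V => ℂ) 2) u = ∑ᶠ v, w u v * (φ : lp (fun _ : V => ℂ) 2) v := rfl

lemma adjacency_eq_sum (col : ∀ v, Memℓp (fun u => w u v) 2) (φ : (adjacency w).domain) :
    (adjacency w φ : lp (fun _ : V => ℂ) 2) = ∑ v ∈ φ.2.1.toFinset,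
      (φ : lp (fun _ : V => ℂ) 2) v • (⟨fun u => w u v, col v⟩ : lp (fun _ : V => ℂ) 2) := by
  ext u
  rw [adjacency_apply, lp.coeFn_sum, Finset.sum_apply,
    finsum_eq_sum_of_support_subset (s := φ.2.1.toFinset)]
  · exact Finset.sum_congr rfl fun v _ => mul_comm _ _
  · rw [Set.Finite.coe_toFinset]
    exact Function.support_mul_subset_right _ _

open scoped Classical in
lemma dense_domain (col : ∀ v, Memℓp (fun u => w u v) 2) :
    Dense ((adjacency w).domain : Set (lp (fun _ : V => ℂ) 2)) := by
  intro φ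
  refine mem_closure_of_tendsto (lp.hasSum_single (by norm_num) φ) (Filter.Eventually.of_forall ?_)
  intro s
  exact Submodule.sum_mem _ fun v _ => single_mem_domain col v _

lemma inner_adjacency (col : ∀ v, Memℓp (fun u => w u v) 2)
    (herm : ∀ u v, w v u = conj (w u v)) {ψ χ : lp (fun _ : V => ℂ) 2}
    (h : ∀ u, ∑' v, w u v * ψ v = χ u) (φ : (adjacency w).domain) :
    inner ℂ (adjacency w φ) ψ = inner ℂ (φ : lp (fun _ : V => ℂ) 2) χ := by
  rw [adjacency_eq_sum col, sum_inner, lp.inner_eq_tsum, tsum_eq_sum (s := φ.2.1.toFinset)]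
  · refine Finset.sum_congr rfl fun v _ => ?_
    rw [inner_smul_left, ← (hasSum_row herm col v ψ).tsum_eq, h]
    simp [mul_comm]
  · intro v hv
    simp only [Set.Finite.mem_toFinset, Function.mem_support, ne_eq, not_not] at hv
    simp [hv]

open scoped Classical in
-- The adjoint is the maximal operator: testing against basis vectors yields the coordinates of the
-- equation, and finitely supported vectors are combinations of these.
lemma mem_adjoint_graph_iff (col : ∀ v, Memℓp (fun u => w u v) 2)
    (herm : ∀ u v, w v u = conj (w u v)) {ψ χ : lp (fun _ : V => ℂ) 2} :
    (ψ, χ) ∈ (LinearPMap.adjoint (adjacency w)).graph ↔ ∀ u, ∑' v, w u v * ψ v = χ u := by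
  rw [LinearPMap.adjoint_graph_eq_graph_adjoint (dense_domain col), Submodule.mem_adjoint_iff]
  constructor
  · intro h u
    have h1 := h _ _ ((adjacency w).mem_graph ⟨lp.single 2 u 1, single_mem_domain col u 1⟩)
    rw [sub_eq_zero, lp.inner_single_left] at h1
    rw [(hasSum_row herm col u ψ).tsum_eq]
    convert h1 using 1
    · congr 1
      ext v
      rw [adjacency_apply, finsum_mul_single, mul_one]
    · simp
  · intro h a b hab
    obtain ⟨y, rfl, rfl⟩ := (LinearPMap.mem_graph_iff _).1 hab
    rw [sub_eq_zero]
    exact inner_adjacency col herm h y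

lemma adjacency_graph_le (col : ∀ v, Memℓp (fun u => w u v) 2)
    (herm : ∀ u v, w v u = conj (w u v)) :
    (adjacency w).graph ≤ (LinearPMap.adjoint (adjacency w)).graph := by
  rintro ⟨ψ, χ⟩ h
  obtain ⟨φ, rfl, rfl⟩ := (LinearPMap.mem_graph_iff _).1 h
  rw [mem_adjoint_graph_iff col herm]
  intro u
  rw [adjacency_apply, tsum_eq_finsum]
  exact φ.2.1.subset (Function.support_mul_subset_right _ _)

lemma adjacency_isClosable (col : ∀ v, Memℓp (fun u => w u v) 2)
    (herm : ∀ u v, w v u = conj (w u v)) : (adjacency w).IsClosable :=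
  (LinearPMap.adjoint_isClosed (dense_domain col)).isClosable.leIsClosable
    (LinearPMap.le_of_le_graph (adjacency_graph_le col herm))

lemma closure_graph_le (col : ∀ v, Memℓp (fun u => w u v) 2)
    (herm : ∀ u v, w v u = conj (w u v)) :
    (adjacency w).closure.graph ≤ (LinearPMap.adjoint (adjacency w)).graph := by
  rw [← (adjacency_isClosable col herm).graph_closure_eq_closure_graph]
  exact Submodule.topologicalClosure_minimal _ (adjacency_graph_le col herm)
    (LinearPMap.adjoint_isClosed (dense_domain col))

/-- Green's identity. -/
lemma inner_closure_graph (col : ∀ v, Memℓp (fun u => w u v) 2)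
    (herm : ∀ u v, w v u = conj (w u v)) {a ψ : lp (fun _ : V => ℂ) 2 × lp (fun _ : V => ℂ) 2}
    (ha : a ∈ (adjacency w).closure.graph)
    (hψ : ψ ∈ (LinearPMap.adjoint (adjacency w)).graph) :
    inner ℂ a.2 ψ.1 = inner ℂ a.1 ψ.2 := by
  rw [← (adjacency_isClosable col herm).graph_closure_eq_closure_graph] at ha
  have hc : IsClosed {a : lp (fun _ : V => ℂ) 2 × lp (fun _ : V => ℂ) 2 |
      inner ℂ a.2 ψ.1 = inner ℂ a.1 ψ.2} :=
    isClosed_eq (by fun_prop) (by fun_prop)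
  refine closure_minimal ?_ hc ha
  rintro ⟨b, c⟩ hbc
  obtain ⟨φ, rfl, rfl⟩ := (LinearPMap.mem_graph_iff _).1 hbc
  exact inner_adjacency col herm ((mem_adjoint_graph_iff col herm).1 hψ) φ

lemma im_inner_eq_zero_of_mem_closure_graph (col : ∀ v, Memℓp (fun u => w u v) 2)
    (herm : ∀ u v, w v u = conj (w u v)) {φ ψ : lp (fun _ : V => ℂ) 2}
    (h : (φ, ψ) ∈ (adjacency w).closure.graph) : (inner ℂ φ ψ : ℂ).im = 0 := by
  have h1 : inner ℂ ψ φ = inner ℂ φ ψ :=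
    inner_closure_graph col herm h (closure_graph_le col herm h)
  rw [← inner_conj_symm] at h1
  exact Complex.conj_eq_iff_im.1 h1

/-- The quadratic form of a symmetric operator is real, so `⟨φ, ψ - c φ⟩` has imaginary part `-Im c
‖φ‖²`; Cauchy–Schwarz finishes. This bound gives injectivity, closed range and the stability of
approximate solutions. -/
lemma norm_le_of_mem_closure_graph (col : ∀ v, Memℓp (fun u => w u v) 2)
    (herm : ∀ u v, w v u = conj (w u v)) {φ ψ : lp (fun _ : V => ℂ) 2}
    (h : (φ, ψ) ∈ (adjacency w).closure.graph) (c : ℂ) :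
    |c.im| * ‖φ‖ ≤ ‖ψ - c • φ‖ := by
  have h1 : (inner ℂ φ (ψ - c • φ) : ℂ).im = - (c.im * ‖φ‖ ^ 2) := by
    rw [inner_sub_right, inner_smul_right, inner_self_eq_norm_sq_to_K]
    simp [im_inner_eq_zero_of_mem_closure_graph col herm h, ← Complex.ofReal_pow]
  have h2 : |c.im| * ‖φ‖ ^ 2 ≤ ‖φ‖ * ‖ψ - c • φ‖ := by
    calc |c.im| * ‖φ‖ ^ 2 = |(inner ℂ φ (ψ - c • φ) : ℂ).im| := by
          rw [h1, abs_neg, abs_mul, abs_of_nonneg (sq_nonneg ‖φ‖)]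
      _ ≤ ‖(inner ℂ φ (ψ - c • φ) : ℂ)‖ := Complex.abs_im_le_norm _
      _ ≤ _ := norm_inner_le_norm _ _
  rcases (norm_nonneg φ).eq_or_lt with h0 | h0
  · rw [← h0, mul_zero]; exact norm_nonneg _
  · exact le_of_mul_le_mul_left (by linarith) h0

/-- The range of `A - c` is closed by the lower bound, and a vector orthogonal to it is an ℓ²
solution for `conj c`, hence zero. -/
lemma IsDeterminate.exists_mem_closure_graph (hw : IsDeterminate w) {c : ℂ} (hc : c.im ≠ 0)
    (χ : lp (fun _ : V => ℂ) 2) : ∃ φ, (φ, χ + c • φ) ∈ (adjacency w).closure.graph := by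
  have hcl : IsClosed ((adjacency w).closure.graph :
      Set (lp (fun _ : V => ℂ) 2 × lp (fun _ : V => ℂ) 2)) :=
    (adjacency_isClosable hw.col hw.herm).closure_isClosed
  have : CompleteSpace (adjacency w).closure.graph := hcl.completeSpace_coe
  let L : (adjacency w).closure.graph →L[ℂ] lp (fun _ : V => ℂ) 2 :=
    ContinuousLinearMap.comp (ContinuousLinearMap.snd ℂ (lp (fun _ : V => ℂ) 2) _ -
      c • ContinuousLinearMap.fst ℂ _ (lp (fun _ : V => ℂ) 2))
      (adjacency w).closure.graph.subtypeL
  have hL : ∀ p, L p = p.1.2 - c • p.1.1 := fun p => rfl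
  have hb : ∀ p, ‖p.1.1‖ ≤ |c.im|⁻¹ * ‖L p‖ := fun p => by
    have := norm_le_of_mem_closure_graph hw.col hw.herm p.2 c
    rw [inv_mul_eq_div, le_div_iff₀ (abs_pos.2 hc), mul_comm]
    exact this
  -- The graph carries the maximum norm. The first component is at most `|c.im|⁻¹ ‖L p‖`, the second
  -- at most `‖L p‖ + ‖c‖` times the first; the constant dominates both bounds.
  have hanti : AntilipschitzWith ((1 + ‖c‖) * |c.im|⁻¹ + 1).toNNReal L := by
    refine AddMonoidHomClass.antilipschitz_of_bound L fun p => ?_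
    rw [Real.coe_toNNReal _ (by positivity)]
    have h2 : ‖p.1.2‖ ≤ ‖L p‖ + ‖c‖ * ‖p.1.1‖ := by
      have : p.1.2 = L p + c • p.1.1 := by rw [hL]; abel
      rw [this]
      exact (norm_add_le _ _).trans (by rw [norm_smul])
    have h3 := mul_le_mul_of_nonneg_left (hb p) (norm_nonneg c)
    have h4 : ‖p‖ = max ‖p.1.1‖ ‖p.1.2‖ := rfl
    have h5 : 0 ≤ ‖c‖ * (|c.im|⁻¹ * ‖L p‖) := by positivity
    have h6 : 0 ≤ |c.im|⁻¹ * ‖L p‖ := by positivity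
    rw [h4]
    refine max_le ?_ ?_
    · have := hb p
      nlinarith [norm_nonneg (L p)]
    · nlinarith [norm_nonneg (L p)]
  let R : Submodule ℂ (lp (fun _ : V => ℂ) 2) := LinearMap.range L.toLinearMap
  have hr : IsClosed (R : Set (lp (fun _ : V => ℂ) 2)) := by
    rw [LinearMap.coe_range]
    exact hanti.isClosed_range L.uniformContinuous
  have : CompleteSpace R := hr.completeSpace_coe
  have htop : R = ⊤ := by
    rw [← Submodule.orthogonal_eq_bot_iff, Submodule.eq_bot_iff]
    intro ψ hψ
    refine hw.eq_zero (conj c) (by simpa using hc) ψ ?_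
    have hmem : (ψ, conj c • ψ) ∈ (LinearPMap.adjoint (adjacency w)).graph := by
      rw [LinearPMap.adjoint_graph_eq_graph_adjoint (dense_domain hw.col),
        Submodule.mem_adjoint_iff]
      intro a b hab
      have := (Submodule.mem_orthogonal _ _).1 hψ (b - c • a)
        ⟨⟨(a, b), LinearPMap.le_graph_of_le (LinearPMap.le_closure _) hab⟩, rfl⟩
      rw [inner_sub_left, inner_smul_left] at this
      rw [inner_smul_right]
      exact this
    exact fun u => (mem_adjoint_graph_iff hw.col hw.herm).1 hmem u
  obtain ⟨p, hp⟩ : χ ∈ R := htop ▸ Submodule.mem_top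
  refine ⟨p.1.1, ?_⟩
  have : χ + c • p.1.1 = p.1.2 := by rw [← hp]; simp [hL]
  rw [this]
  exact p.2

lemma IsDeterminate.adjoint_eq_closure (hw : IsDeterminate w) :
    LinearPMap.adjoint (adjacency w) = (adjacency w).closure := by
  refine LinearPMap.eq_of_eq_graph (le_antisymm ?_ (closure_graph_le hw.col hw.herm))
  rintro ⟨ψ, χ⟩ h
  -- Von Neumann's argument: the closure already attains the value of `A* - i` at `ψ`, so the
  -- difference of the two arguments lies in a deficiency space, which is trivial.
  obtain ⟨φ, hφ⟩ := hw.exists_mem_closure_graph (c := Complex.I) (by simp) (χ - Complex.I • ψ)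
  have h1 := Submodule.sub_mem _ h (closure_graph_le hw.col hw.herm hφ)
  have h2 : ψ - φ = 0 := by
    refine hw.eq_zero Complex.I (by simp) _ fun u => ?_
    have := (mem_adjoint_graph_iff hw.col hw.herm).1 h1 u
    have h3 : χ - (χ - Complex.I • ψ + Complex.I • φ) = Complex.I • (ψ - φ) := by module
    simp only [h3] at this
    exact this
  rw [sub_eq_zero] at h2
  subst h2
  simpa using hφ

/-- The adjoint of the closure lies in the adjoint of the original operator, which equals the
closure; the other inclusion is Green's identity. -/
theorem IsDeterminate.isSelfAdjointAdjacency (hw : IsDeterminate w) :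
    IsSelfAdjointAdjacency w := by
  refine ⟨hw.col, ?_⟩
  have hd : Dense ((adjacency w).closure.domain : Set (lp (fun _ : V => ℂ) 2)) :=
    (dense_domain hw.col).mono (LinearPMap.le_closure _).1
  rw [LinearPMap.isSelfAdjoint_def]
  refine LinearPMap.eq_of_eq_graph ?_
  rw [LinearPMap.adjoint_graph_eq_graph_adjoint hd]
  refine le_antisymm ?_ ?_
  · intro p hp
    rw [← hw.adjoint_eq_closure, LinearPMap.adjoint_graph_eq_graph_adjoint (dense_domain hw.col)]
    rw [Submodule.mem_adjoint_iff] at hp ⊢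
    exact fun a b hab => hp a b (LinearPMap.le_graph_of_le (LinearPMap.le_closure _) hab)
  · intro p hp
    rw [Submodule.mem_adjoint_iff]
    exact fun a b hab => sub_eq_zero.2
      (inner_closure_graph hw.col hw.herm hab (closure_graph_le hw.col hw.herm hp))

open scoped Classical in
/-- The resolvent entry is the value at `o` of the solution of `(w - η) φ = δ_o`. -/
lemma IsDeterminate.exists_rootResolvent_eq (hw : IsDeterminate w) (o : V) {η : ℂ}
    (hη : η.im ≠ 0) : ∃ φ : lp (fun _ : V => ℂ) 2,
      (φ, (lp.single 2 o 1 : lp (fun _ : V => ℂ) 2) + η • φ) ∈ (adjacency w).closure.graph ∧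
      rootResolvent w o η = φ o := by
  obtain ⟨φ, hφ⟩ := hw.exists_mem_closure_graph hη (lp.single 2 o 1)
  refine ⟨φ, hφ, ?_⟩
  obtain ⟨y, hy, hy'⟩ := (LinearPMap.mem_graph_iff _).1 hφ
  simp only at hy hy'
  let B : lp (fun _ : V => ℂ) 2 →ₗ.[ℂ] lp (fun _ : V => ℂ) 2 :=
    ((-η) • (LinearMap.id : lp (fun _ : V => ℂ) 2 →ₗ[ℂ] lp (fun _ : V => ℂ) 2)) +ᵥ
      (adjacency w).closure
  have hB : ∀ x : (adjacency w).closure.domain,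
      B x = (adjacency w).closure x - η • (x : lp (fun _ : V => ℂ) 2) := fun x => by
    change (-η) • (x : lp (fun _ : V => ℂ) 2) + (adjacency w).closure x = _
    rw [neg_smul]; abel
  -- Injectivity matters because the partially defined inverse has its intended values only for a
  -- trivial kernel.
  have hker : LinearMap.ker B.toFun = ⊥ := by
    rw [LinearMap.ker_eq_bot']
    intro x hx
    have h1 : (adjacency w).closure x - η • (x : lp (fun _ : V => ℂ) 2) = 0 :=
      (hB x).symm.trans hx
    have h2 := norm_le_of_mem_closure_graph hw.col hw.herm
      ((adjacency w).closure.mem_graph x) η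
    rw [h1, norm_zero] at h2
    have h3 : ‖(x : lp (fun _ : V => ℂ) 2)‖ = 0 := by
      have := abs_pos.2 hη
      have h0 := norm_nonneg (x : lp (fun _ : V => ℂ) 2)
      nlinarith
    exact Subtype.ext (norm_eq_zero.1 h3)
  have hBy : B y = (lp.single 2 o 1 : lp (fun _ : V => ℂ) 2) := by
    rw [hB, hy', hy]; simp
  have hmem : (lp.single 2 o 1 : lp (fun _ : V => ℂ) 2) ∈ B.inverse.domain := by
    rw [LinearPMap.inverse_domain]
    exact ⟨y, hBy⟩
  unfold rootResolvent resolventEntry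
  change (if he : _ ∈ B.inverse.domain then inner ℂ _ (B.inverse ⟨_, he⟩) else 0) = _
  rw [dif_pos hmem, LinearPMap.inverse_apply_eq hker (x := y) hBy]
  rw [lp.inner_single_left, hy]
  simp

open scoped Classical in
lemma IsDeterminate.exists_solution (hw : IsDeterminate w) (o : V) {η : ℂ} (hη : η.im ≠ 0) :
    ∃ φ : lp (fun _ : V => ℂ) 2,
      (∀ u, ∑' v, w u v * φ v = (if u = o then 1 else 0) + η * φ u) ∧
      rootResolvent w o η = φ o ∧ (φ o).im = η.im * ‖φ‖ ^ 2 ∧ φ o ≠ 0 := by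
  obtain ⟨φ, hφ, h⟩ := hw.exists_rootResolvent_eq o hη
  have hsol : ∀ u, ∑' v, w u v * φ v = (if u = o then 1 else 0) + η * φ u := fun u => by
    rw [(mem_adjoint_graph_iff hw.col hw.herm).1 (closure_graph_le hw.col hw.herm hφ) u,
      ← single_apply_eq_ite]
    rfl
  have him : (φ o).im = η.im * ‖φ‖ ^ 2 := by
    have h1 := im_inner_eq_zero_of_mem_closure_graph hw.col hw.herm hφ
    rw [inner_add_right, inner_smul_right, inner_self_eq_norm_sq_to_K, lp.inner_single_right] at h1
    simp [← Complex.ofReal_pow] at h1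
    linarith
  refine ⟨φ, hsol, h, him, fun h0 => ?_⟩
  have hφ0 : φ = 0 := by
    rw [h0] at him
    simpa [hη] using him
  have := hsol o
  simp [hφ0] at this

open scoped Classical in
/-- The square summable solution of `(w - η) φ = δ_o` determines the resolvent entry. -/
lemma IsDeterminate.rootResolvent_eq (hw : IsDeterminate w) {o : V} {η : ℂ} (hη : η.im ≠ 0)
    {φ : lp (fun _ : V => ℂ) 2}
    (hφ : ∀ u, ∑' v, w u v * φ v = (if u = o then 1 else 0) + η * φ u) :
    rootResolvent w o η = φ o := by
  obtain ⟨ψ, hψ, h, -⟩ := hw.exists_solution o hη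
  have : φ - ψ = 0 := by
    refine hw.eq_zero η hη _ fun u => ?_
    have h1 : ∀ v, w u v * (φ - ψ : lp (fun _ : V => ℂ) 2) v = w u v * φ v - w u v * ψ v :=
      fun v => mul_sub _ _ _
    simp_rw [h1]
    rw [(hasSum_row hw.herm hw.col u φ).summable.tsum_sub
      (hasSum_row hw.herm hw.col u ψ).summable, hφ, hψ]
    change _ = η * (φ u - ψ u)
    ring
  rw [h, sub_eq_zero.1 this]

lemma IsDeterminate.rootResolvent_im_pos (hw : IsDeterminate w) (o : V) {η : ℂ} (hη : 0 < η.im) :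
    0 < (rootResolvent w o η).im := by
  obtain ⟨φ, -, h, him, h0⟩ := hw.exists_solution o hη.ne'
  rw [h, him]
  have : φ ≠ 0 := fun h => h0 (by simp [h])
  have := norm_pos_iff.2 this
  positivity

/-- For the solution `φ`, `Im η ‖φ‖² = Im (φ o) ≤ ‖φ o‖` while `‖φ o‖ ≤ ‖φ‖`. -/
lemma IsDeterminate.norm_rootResolvent_le (hw : IsDeterminate w) (o : V) {η : ℂ}
    (hη : 0 < η.im) : ‖rootResolvent w o η‖ ≤ η.im⁻¹ := by
  obtain ⟨φ, -, h, him, h0⟩ := hw.exists_solution o hη.ne'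
  rw [h]
  have h1 : ‖φ o‖ ≤ ‖φ‖ := lp.norm_apply_le_norm (by norm_num) φ o
  have h2 : η.im * ‖φ‖ ^ 2 ≤ ‖φ o‖ := him ▸ (le_abs_self _).trans (Complex.abs_im_le_norm _)
  have h3 : 0 < ‖φ o‖ := norm_pos_iff.2 h0
  rw [le_inv_comm₀ h3 hη, inv_eq_one_div, le_div_iff₀ h3]
  have h4 : ‖φ o‖ * ‖φ o‖ ≤ ‖φ‖ ^ 2 := by nlinarith [norm_nonneg φ]
  have h5 : (η.im * ‖φ o‖) * ‖φ o‖ ≤ 1 * ‖φ o‖ := by nlinarith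
  exact le_of_mul_le_mul_right h5 h3

open scoped Classical in
/-- Finitely supported vectors `a` for which `(w - η) a` is close to `δ_o` are close to the
solution. -/
lemma IsDeterminate.norm_rootResolvent_sub_le (hw : IsDeterminate w) (o : V) {η : ℂ}
    (hη : η.im ≠ 0) (a : (adjacency w).domain) :
    |η.im| * ‖rootResolvent w o η - (a : lp (fun _ : V => ℂ) 2) o‖ ≤
      ‖adjacency w a - η • (a : lp (fun _ : V => ℂ) 2) - lp.single 2 o 1‖ := by
  obtain ⟨φ, hφ, h⟩ := hw.exists_rootResolvent_eq o hη
  have h1 := norm_le_of_mem_closure_graph hw.col hw.herm (Submodule.sub_mem _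
    (LinearPMap.le_graph_of_le (LinearPMap.le_closure _) ((adjacency w).mem_graph a)) hφ) η
  have h2 : ‖rootResolvent w o η - (a : lp (fun _ : V => ℂ) 2) o‖ ≤
      ‖(a : lp (fun _ : V => ℂ) 2) - φ‖ := by
    rw [h, norm_sub_rev]
    exact lp.norm_apply_le_norm (by norm_num) ((a : lp (fun _ : V => ℂ) 2) - φ) o
  refine (mul_le_mul_of_nonneg_left h2 (abs_nonneg _)).trans (h1.trans (le_of_eq ?_))
  congr 1
  module

open scoped Classical in
-- Finitely supported vectors are a core: the solution lies in the closure of their graph. This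
-- approximation underlies measurability.
lemma IsDeterminate.exists_norm_lt (hw : IsDeterminate w) (o : V) {η : ℂ}
    (hη : η.im ≠ 0) {ε : ℝ} (hε : 0 < ε) : ∃ a : (adjacency w).domain,
      ‖adjacency w a - η • (a : lp (fun _ : V => ℂ) 2) - lp.single 2 o 1‖ < ε := by
  obtain ⟨φ, hφ, -⟩ := hw.exists_rootResolvent_eq o hη
  rw [← (adjacency_isClosable hw.col hw.herm).graph_closure_eq_closure_graph] at hφ
  have ho : IsOpen {p : lp (fun _ : V => ℂ) 2 × lp (fun _ : V => ℂ) 2 |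
      ‖p.2 - η • p.1 - lp.single 2 o 1‖ < ε} := isOpen_lt (by fun_prop) (by fun_prop)
  obtain ⟨p, hp, hp'⟩ := mem_closure_iff.1 hφ _ ho (by simpa using hε)
  obtain ⟨a, ha, ha'⟩ := (LinearPMap.mem_graph_iff _).1 hp'
  refine ⟨a, ?_⟩
  rw [ha, ha']
  exact hp

end Determinate

end

section

/-! ### Restriction to a union of connected components -/

section Restriction

variable {V : Type*} {w : V → V → ℂ}

lemma memℓp_two_iff {f : V → ℂ} : Memℓp f 2 ↔ Summable fun v => ‖f v‖ ^ 2 := by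
  rw [memℓp_gen_iff (by norm_num)]
  norm_num

lemma summable_norm_sq (φ : lp (fun _ : V => ℂ) 2) : Summable fun v => ‖φ v‖ ^ 2 :=
  memℓp_two_iff.1 (lp.memℓp φ)

open scoped Classical in
-- Uniqueness with a source of arbitrary size `d`. In the recursion `d` is the coupling of a subtree
-- to its parent.
lemma IsDeterminate.eq_mul_rootResolvent (hw : IsDeterminate w) {o : V} {η d : ℂ} (hη : η.im ≠ 0)
    {φ : lp (fun _ : V => ℂ) 2}
    (hφ : ∀ u, ∑' v, w u v * φ v = (if u = o then d else 0) + η * φ u) :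
    φ o = d * rootResolvent w o η := by
  obtain ⟨ψ, hψ, h, -⟩ := hw.exists_solution o hη
  have : φ - d • ψ = 0 := by
    refine hw.eq_zero η hη _ fun u => ?_
    have h1 : ∀ v, w u v * (φ - d • ψ : lp (fun _ : V => ℂ) 2) v =
        w u v * φ v - d * (w u v * ψ v) := fun v => by
      change w u v * (φ v - d * ψ v) = _
      ring
    simp_rw [h1]
    rw [(hasSum_row hw.herm hw.col u φ).summable.tsum_sub
      ((hasSum_row hw.herm hw.col u ψ).summable.mul_left d), hφ, tsum_mul_left, hψ]
    change _ = η * (φ u - d * ψ u)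
    split_ifs <;> ring
  rw [h, sub_eq_zero.1 this]
  rfl

variable {S : Set V}

lemma tsum_coe_eq_tsum {f : V → ℂ} (hf : ∀ v ∉ S, f v = 0) : ∑' v : S, f v = ∑' v, f v :=
  tsum_subtype_eq_of_support_subset fun v hv => by
    by_contra h
    exact hv (hf v h)

/-- The restriction of determinate weights to a union of connected components. -/
lemma IsDeterminate.restrict (hw : IsDeterminate w) (hS : ∀ u ∈ S, ∀ v ∉ S, w u v = 0) :
    IsDeterminate fun u v : S => w u v where
  herm u v := hw.herm u v
  col v := memℓp_two_iff.2 ((memℓp_two_iff.1 (hw.col v)).comp_injective Subtype.val_injective)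
  eq_zero c hc φ hφ := by
    classical
    let f : V → ℂ := fun v => if h : v ∈ S then φ ⟨v, h⟩ else 0
    have hf0 : ∀ v ∉ S, f v = 0 := fun v hv => dif_neg hv
    have hfS : ∀ v : S, f v = φ v := fun v => dif_pos v.2
    have hf : Memℓp f 2 := by
      rw [memℓp_two_iff, ← (Subtype.val_injective (p := (· ∈ S))).summable_iff
        (f := fun v => ‖f v‖ ^ 2) (fun x hx => by
          rw [hf0 x (by simpa using hx)]; simp)]
      refine (summable_norm_sq φ).congr fun v => ?_
      rw [Function.comp_apply, hfS]
    have h0 : (⟨f, hf⟩ : lp (fun _ : V => ℂ) 2) = 0 := by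
      refine hw.eq_zero c hc _ fun u => ?_
      change ∑' v, w u v * f v = c * f u
      rw [← tsum_coe_eq_tsum (S := S) fun v hv => by rw [hf0 v hv, mul_zero]]
      simp_rw [hfS]
      by_cases hu : u ∈ S
      · rw [show f u = φ ⟨u, hu⟩ from dif_pos hu, ← hφ]
      · rw [hf0 u hu, mul_zero]
        convert tsum_zero with v
        rw [hw.herm v u, hS v v.2 u hu, map_zero, zero_mul]
    ext v
    rw [← hfS]
    exact congrArg (fun g : lp (fun _ : V => ℂ) 2 => g v) h0

lemma IsDeterminate.rootResolvent_restrict (hw : IsDeterminate w)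
    (hS : ∀ u ∈ S, ∀ v ∉ S, w u v = 0) {o : V} (ho : o ∈ S) {η : ℂ} (hη : η.im ≠ 0) :
    rootResolvent (fun u v : S => w u v) ⟨o, ho⟩ η = rootResolvent w o η := by
  classical
  obtain ⟨φ, hφ, h, -⟩ := hw.exists_solution o hη
  have hmem : Memℓp (fun v : S => φ v) 2 :=
    memℓp_two_iff.2 ((summable_norm_sq φ).comp_injective Subtype.val_injective)
  rw [h, (hw.restrict hS).rootResolvent_eq hη
    (φ := (⟨fun v => φ v, hmem⟩ : lp (fun _ : S => ℂ) 2))]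
  intro u
  change ∑' v : S, w u v * φ v = _ + η * φ u
  rw [tsum_coe_eq_tsum (f := fun v => w u v * φ v) fun v hv => by rw [hS u u.2 v hv, zero_mul], hφ]
  congr 2
  simp [Subtype.ext_iff]

end Restriction

/-! ### Weighted trees on words -/

section WordTree

variable {ι : Type*} [DecidableEq ι]

/-- Hermitian weights of the tree on words with the weight `e k a` on the edge from `k` to
`a :: k`. -/
def wordWeight (e : List ι → ι → ℂ) (u v : List ι) : ℂ :=
  (match v with
    | a :: k => if k = u then e u a else 0
    | [] => 0) +
  (match u with
    | a :: k => if k = v then conj (e v a) else 0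
    | [] => 0)

/-- The contribution of the parent to the action of the adjacency operator. -/
def parentTerm (e : List ι → ι → ℂ) (φ : List ι → ℂ) : List ι → ℂ
  | a :: k => conj (e k a) * φ k
  | [] => 0

/-- The weights of the subtree at the child `[a]` of the root. -/
def subtree (e : List ι → ι → ℂ) (a : ι) (k : List ι) : ι → ℂ := e (k ++ [a])

/-- All edges are strong or weak, the weak edges to the children have square sums bounded
uniformly in the vertex, and no vertex is between two strong edges on a descending path. -/
def IsTame (e : List ι → ι → ℂ) : Prop :=
  (∀ k, Summable fun a => ‖e k a‖ ^ 2) ∧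
  ∃ (strong : List ι → ι → Prop) (K : ℝ),
    (∀ k (s : Finset ι), (∀ a ∈ s, ¬ strong k a) → ∑ a ∈ s, ‖e k a‖ ^ 2 ≤ K) ∧
    ∀ k a b, strong k a → ¬ strong (a :: k) b

omit [DecidableEq ι] in
lemma isTame_subtree {e : List ι → ι → ℂ} (he : IsTame e) (a : ι) : IsTame (subtree e a) := by
  obtain ⟨h1, strong, K, h2, h3⟩ := he
  exact ⟨fun k => h1 _, fun k => strong (k ++ [a]), K, fun k => h2 _, fun k b c => h3 _ b c⟩

lemma hasSum_children {R : Type*} [AddCommMonoid R] [TopologicalSpace R] {f : ι → R} {s : R}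
    (hf : HasSum f s) (u : List ι) :
    HasSum (fun v : List ι => match v with
      | a :: k => if k = u then f a else 0
      | [] => 0) s := by
  have hinj : Function.Injective fun a : ι => a :: u := fun a b h => (List.cons.inj h).1
  rw [← hinj.hasSum_iff]
  · convert hf using 1
    funext a
    simp
  · rintro (_ | ⟨a, k⟩) hv
    · rfl
    · refine if_neg fun h => hv ⟨a, by rw [h]⟩

lemma hasSum_wordWeight {e : List ι → ι → ℂ} {φ : List ι → ℂ} {u : List ι} {s : ℂ}
    (hs : HasSum (fun a => e u a * φ (a :: u)) s) :
    HasSum (fun v => wordWeight e u v * φ v) (s + parentTerm e φ u) := by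
  simp only [wordWeight, add_mul]
  refine HasSum.add ?_ ?_
  · convert hasSum_children hs u using 1
    funext v
    cases v with
    | nil => simp
    | cons a k =>
      by_cases h : k = u
      · simp [h]
      · simp [h]
  · cases u with
    | nil => simp [parentTerm]
    | cons a k =>
      convert hasSum_single k fun v hv => ?_ using 1
      · simp [parentTerm]
      · simp [Ne.symm hv]

lemma wordWeight_herm (e : List ι → ι → ℂ) (u v : List ι) :
    wordWeight e v u = conj (wordWeight e u v) := by
  unfold wordWeight
  rw [add_comm, map_add]
  congr 1
  · cases v with
    | nil => simp
    | cons a k => by_cases h : k = u <;> simp [h]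
  · cases u with
    | nil => simp
    | cons a k => by_cases h : k = v <;> simp [h]

lemma memℓp_wordWeight {e : List ι → ι → ℂ} {v : List ι} (h : Summable fun a => ‖e v a‖ ^ 2) :
    Memℓp (fun u => wordWeight e u v) 2 := by
  have hsplit : (fun u => wordWeight e u v) =
      (fun u => match (generalizing := false) v with
        | a :: k => if k = u then e u a else 0
        | [] => 0) +
      (fun u => match u with
        | a :: k => if k = v then conj (e v a) else 0
        | [] => 0) := rfl
  rw [hsplit]
  refine Memℓp.add ?_ ?_
  · rw [memℓp_two_iff]
    cases v with
    | nil => simp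
    | cons a k =>
      refine (hasSum_single k fun u hu => ?_).summable
      simp [Ne.symm hu]
  · rw [memℓp_two_iff]
    convert (hasSum_children h.hasSum v).summable using 1
    funext u
    cases u with
    | nil => simp
    | cons a k => by_cases h : k = v <;> simp [h]

omit [DecidableEq ι] in
lemma summable_mul_children {e : List ι → ι → ℂ} {u : List ι} (h : Summable fun a => ‖e u a‖ ^ 2)
    (φ : lp (fun _ : List ι => ℂ) 2) : Summable fun a => e u a * φ (a :: u) := by
  have hinj : Function.Injective fun a : ι => a :: u := fun a b h => (List.cons.inj h).1
  refine Summable.of_norm_bounded (h.add ((summable_norm_sq φ).comp_injective hinj)) fun a => ?_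
  simp only [Function.comp_apply, norm_mul]
  nlinarith [sq_nonneg (‖e u a‖ - ‖φ (a :: u)‖), sq_nonneg (‖e u a‖ + ‖φ (a :: u)‖)]

lemma tsum_wordWeight {e : List ι → ι → ℂ} {u : List ι} (h : Summable fun a => ‖e u a‖ ^ 2)
    (φ : lp (fun _ : List ι => ℂ) 2) :
    ∑' v, wordWeight e u v * φ v = ∑' a, e u a * φ (a :: u) + parentTerm e φ u :=
  (hasSum_wordWeight (summable_mul_children h φ).hasSum).tsum_eq

omit [DecidableEq ι] in
lemma cons_uncurry_injective : Function.Injective fun p : List ι × ι => p.2 :: p.1 :=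
  fun p q h => by
    obtain ⟨h1, h2⟩ := List.cons.inj h
    exact Prod.ext h2 h1

omit [DecidableEq ι] in
lemma summable_norm_edgeTerm {e : List ι → ι → ℂ} {K : ℝ}
    (hle : ∀ k (s : Finset ι), ∑ a ∈ s, ‖e k a‖ ^ 2 ≤ K) (φ : lp (fun _ : List ι => ℂ) 2) :
    Summable fun p : List ι × ι => ‖conj (φ p.1) * (e p.1 p.2 * φ (p.2 :: p.1))‖ := by
  have hφ2 := summable_norm_sq φ
  have hsum : ∀ k, Summable fun a => ‖e k a‖ ^ 2 := fun k =>
    summable_of_sum_le (fun a => sq_nonneg _) (hle k)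
  have hpair : Summable fun p : List ι × ι => ‖φ p.1‖ ^ 2 * ‖e p.1 p.2‖ ^ 2 := by
    refine (summable_prod_of_nonneg fun p => by positivity).2 ⟨fun k => ?_, ?_⟩
    · exact (hsum k).mul_left (‖φ k‖ ^ 2)
    simp only [tsum_mul_left]
    refine Summable.of_nonneg_of_le (fun k => ?_) (fun k => ?_) (hφ2.mul_right K)
    · exact mul_nonneg (sq_nonneg _) (tsum_nonneg fun a => sq_nonneg _)
    · exact mul_le_mul_of_nonneg_left ((hsum k).tsum_le_of_sum_le (hle k)) (sq_nonneg _)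
  -- The weight is grouped with the value at the parent and the product is split by the
  -- arithmetic-geometric mean inequality. The squared weights summed over children are at most `K`,
  -- and each vertex is the child of at most one parent.
  refine Summable.of_nonneg_of_le (fun p => norm_nonneg _) (fun p => ?_)
    (hpair.add (hφ2.comp_injective cons_uncurry_injective))
  rw [norm_mul, norm_mul, Complex.norm_conj, Function.comp_apply]
  nlinarith [sq_nonneg (‖φ p.1‖ * ‖e p.1 p.2‖ - ‖φ (p.2 :: p.1)‖),
    sq_nonneg (‖φ p.1‖ * ‖e p.1 p.2‖ + ‖φ (p.2 :: p.1)‖)]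

/-- The edge terms of the quadratic form of a solution are absolutely summable. -/
lemma IsTame.summable_edgeTerm {e : List ι → ι → ℂ} (he : IsTame e) {c : ℂ}
    {φ : lp (fun _ : List ι => ℂ) 2}
    (hφ : ∀ u, ∑' v, wordWeight e u v * φ v = c * φ u) :
    Summable fun p : List ι × ι => conj (φ p.1) * (e p.1 p.2 * φ (p.2 :: p.1)) := by
  classical
  obtain ⟨hcol, strong, K, hK, hstrong⟩ := he
  set t : List ι × ι → ℂ := fun p => conj (φ p.1) * (e p.1 p.2 * φ (p.2 :: p.1)) with ht
  have hφ2 := summable_norm_sq φ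
  have hchild : Summable fun p : List ι × ι => ‖φ (p.2 :: p.1)‖ ^ 2 :=
    hφ2.comp_injective cons_uncurry_injective
  -- Only the weak edges are kept; their terms are summable without using the equation.
  let e' : List ι → ι → ℂ := fun k a => if strong k a then 0 else e k a
  have hle : ∀ k (s : Finset ι), ∑ a ∈ s, ‖e' k a‖ ^ 2 ≤ K := fun k s => by
    have := hK k (s.filter fun a => ¬ strong k a) (by simp)
    refine le_trans (le_of_eq ?_) this
    rw [Finset.sum_filter]
    refine Finset.sum_congr rfl fun a _ => ?_
    by_cases h : strong k a <;> simp [e', h]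
  have hweak := summable_norm_edgeTerm hle φ
  have hrow : Summable fun k : List ι =>
      ∑' a, ‖conj (φ k) * (e' k a * φ (a :: k))‖ := hweak.prod
  have hmaj : Summable fun p : List ι × ι => ‖c‖ * ‖φ (p.2 :: p.1)‖ ^ 2 +
      ∑' b, ‖conj (φ (p.2 :: p.1)) * (e' (p.2 :: p.1) b * φ (b :: p.2 :: p.1))‖ :=
    (hchild.mul_left _).add (hrow.comp_injective cons_uncurry_injective)
  refine Summable.of_norm_bounded (hweak.add hmaj) fun ⟨k, a⟩ => ?_
  have hpos : 0 ≤ ∑' b, ‖conj (φ (a :: k)) * (e' (a :: k) b * φ (b :: a :: k))‖ :=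
    tsum_nonneg fun b => norm_nonneg _
  by_cases hs : strong k a
  · have h1 := hφ (a :: k)
    rw [tsum_wordWeight (hcol _)] at h1
    have h2 : ∀ b, e' (a :: k) b = e (a :: k) b := fun b => if_neg (hstrong k a b hs)
    -- At the lower end of a strong edge all edges to children are weak. Multiplying the equation
    -- there by the conjugate of `φ` isolates the strong term, the contribution of the parent.
    have h3 : conj (t (k, a)) = c * (conj (φ (a :: k)) * φ (a :: k)) -
        ∑' b, conj (φ (a :: k)) * (e' (a :: k) b * φ (b :: a :: k)) := by
      rw [tsum_mul_left]
      simp_rw [h2]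
      rw [← mul_left_comm, ← h1, parentTerm, ht]
      simp only [map_mul, Complex.conj_conj]
      ring
    have h4 : ‖t (k, a)‖ ≤ ‖c‖ * ‖φ (a :: k)‖ ^ 2 +
        ∑' b, ‖conj (φ (a :: k)) * (e' (a :: k) b * φ (b :: a :: k))‖ := by
      rw [← Complex.norm_conj, h3]
      refine (norm_sub_le _ _).trans (add_le_add (le_of_eq ?_) ?_)
      · rw [norm_mul, norm_mul, Complex.norm_conj, sq]
      · exact norm_tsum_le_tsum_norm (hweak.prod_factor (a :: k))
    exact h4.trans (le_add_of_nonneg_left (norm_nonneg _))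
  · have : e' k a = e k a := if_neg hs
    simp only [this]
    refine le_add_of_nonneg_right (add_nonneg (by positivity) hpos)

/-- Absolute summability of the edge terms permits summing the pairing of the equation with `φ` edge
by edge. Each edge contributes a term from its upper end and the conjugate from its lower end. -/
theorem IsTame.isDeterminate {e : List ι → ι → ℂ} (he : IsTame e) :
    IsDeterminate (wordWeight e) where
  herm := wordWeight_herm e
  col v := memℓp_wordWeight (he.1 v)
  eq_zero c hc φ hφ := by
    have ht := he.summable_edgeTerm hφ
    set t : List ι × ι → ℂ := fun p => conj (φ p.1) * (e p.1 p.2 * φ (p.2 :: p.1)) with ht_def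
    have h1 : HasSum (fun u => ∑' a, t (u, a)) (∑' p, t p) :=
      ht.hasSum.prod_fiberwise fun u => (ht.prod_factor u).hasSum
    have h2 : HasSum (fun u => conj (φ u) * parentTerm e φ u) (∑' p, conj (t p)) := by
      rw [← (cons_uncurry_injective (ι := ι)).hasSum_iff]
      · have h3 : Summable fun p => conj (t p) :=
          Complex.summable_conj.2 ht
        refine h3.hasSum.congr_fun fun p => ?_
        simp only [Function.comp_apply, parentTerm, ht_def, map_mul, Complex.conj_conj]
        ring
      · rintro (_ | ⟨a, k⟩) hu
        · simp [parentTerm]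
        · exact absurd ⟨(k, a), rfl⟩ hu
    have h3 : HasSum (fun u => c * (‖φ u‖ ^ 2 : ℝ)) (∑' p, t p + conj (∑' p, t p)) := by
      rw [Complex.conj_tsum]
      refine (h1.add h2).congr_fun fun u => ?_
      have h4 := hφ u
      rw [tsum_wordWeight (he.1 u)] at h4
      simp only [ht_def]
      rw [tsum_mul_left, ← mul_add, h4, Complex.ofReal_pow, ← Complex.conj_mul']
      ring
    have h5 : HasSum (fun u => c * (‖φ u‖ ^ 2 : ℝ)) (c * (∑' u, ‖φ u‖ ^ 2 : ℝ)) :=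
      (Complex.hasSum_ofReal.2 (summable_norm_sq φ).hasSum).mul_left c
    -- One evaluation is a number plus its conjugate, hence real; the other has imaginary part `Im c
    -- ‖φ‖²`.
    have h6 := congrArg Complex.im (h3.unique h5)
    simp only [Complex.add_im, Complex.conj_im, add_neg_cancel, Complex.mul_im, Complex.ofReal_im,
      mul_zero, Complex.ofReal_re, zero_add] at h6
    have h7 : ∑' u, ‖φ u‖ ^ 2 = 0 := by
      rcases mul_eq_zero.1 h6.symm with h | h
      · exact absurd h hc
      · exact h
    have h8 := (hasSum_zero_iff_of_nonneg fun u => sq_nonneg ‖φ u‖).1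
      (h7 ▸ (summable_norm_sq φ).hasSum)
    ext u
    simpa using congrFun h8 u

/-- The resolvent entry at the root of a tree on words. -/
def treeRes (e : List ι → ι → ℂ) (η : ℂ) : ℂ := rootResolvent (wordWeight e) [] η

/-- The recursion for the resolvent entry at the root of a tree. -/
theorem IsTame.treeRes_eq {e : List ι → ι → ℂ} (he : IsTame e) {η : ℂ} (hη : 0 < η.im) :
    treeRes e η = psi η (∑' a, (‖e [] a‖ : ℂ) ^ 2 * treeRes (subtree e a) η) := by
  classical
  obtain ⟨φ, hφ, h, -, -⟩ := he.isDeterminate.exists_solution [] hη.ne'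
  -- On the words ending in `a` the solution satisfies the equation of the subtree, except that the
  -- term of the parent at `[a]` moves to the right-hand side as a source.
  have hsub : ∀ a, φ [a] = -(conj (e [] a) * φ []) * treeRes (subtree e a) η := fun a => by
    have hinj : Function.Injective fun k : List ι => k ++ [a] :=
      fun k l h => List.append_cancel_right h
    have hmem : Memℓp (fun k : List ι => φ (k ++ [a])) 2 :=
      memℓp_two_iff.2 ((summable_norm_sq φ).comp_injective hinj)
    refine (isTame_subtree he a).isDeterminate.eq_mul_rootResolvent hη.ne' (o := [])
      (φ := (⟨fun k => φ (k ++ [a]), hmem⟩ : lp (fun _ : List ι => ℂ) 2)) fun k => ?_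
    rw [tsum_wordWeight ((isTame_subtree he a).1 k)]
    change ∑' b, e (k ++ [a]) b * φ (b :: (k ++ [a])) + _ = _ + η * φ (k ++ [a])
    have h1 := hφ (k ++ [a])
    rw [tsum_wordWeight (he.1 _), if_neg (by simp), zero_add] at h1
    rw [← h1]
    cases k with
    | nil => simp [parentTerm]
    | cons b k => simp [parentTerm, subtree]
  have h0 := hφ []
  rw [tsum_wordWeight (he.1 _), if_pos rfl] at h0
  simp only [hsub, parentTerm, add_zero] at h0
  have h2 : ∀ a, e [] a * (-(conj (e [] a) * φ []) * treeRes (subtree e a) η) =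
      -φ [] * ((‖e [] a‖ : ℂ) ^ 2 * treeRes (subtree e a) η) := fun a => by
    rw [← Complex.mul_conj']
    ring
  simp_rw [h2, tsum_mul_left] at h0
  rw [treeRes, h, psi]
  refine eq_neg_of_add_eq_zero_left ?_
  set s := ∑' a, (‖e [] a‖ : ℂ) ^ 2 * treeRes (subtree e a) η
  have h3 : φ [] * (η + s) = -1 := by linear_combination -h0
  have h4 : η + s ≠ 0 := fun h => by rw [h, mul_zero] at h3; norm_num at h3
  field_simp
  linear_combination h3

lemma IsTame.treeRes_im_pos {e : List ι → ι → ℂ} (he : IsTame e) {η : ℂ} (hη : 0 < η.im) :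
    0 < (treeRes e η).im := he.isDeterminate.rootResolvent_im_pos _ hη

lemma IsTame.norm_treeRes_le {e : List ι → ι → ℂ} (he : IsTame e) {η : ℂ} (hη : 0 < η.im) :
    ‖treeRes e η‖ ≤ η.im⁻¹ := he.isDeterminate.norm_rootResolvent_le _ hη

end WordTree

end

section

lemma hasSum_option {α R : Type*} [AddCommMonoid R] [TopologicalSpace R] [ContinuousAdd R]
    {f : Option α → R} {s : R} (h : HasSum (fun a => f (some a)) s) : HasSum f (f none + s) := by
  classical
  have h1 : HasSum (fun a : Option α => if a = none then f none else 0) (f none) := by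
    simpa using hasSum_ite_eq (none : Option α) (f none)
  have h2 : HasSum (fun a : Option α => if a = none then 0 else f a) s := by
    rw [← (Option.some_injective α).hasSum_iff]
    · simpa [Function.comp_def] using h
    · rintro (_ | a) ha
      · simp
      · exact absurd ⟨a, rfl⟩ ha
  refine (h1.add h2).congr_fun fun a => ?_
  by_cases ha : a = none <;> simp [ha]

/-! ### The alternate trees as trees on all words -/

/-- The vertices of the two kinds of trees. -/
def vertexSet (b : Bool) : Set Word := if b then barVertices else vertices

/-- The point of the edge from the parent, where the root has the point `p`. -/
def pointAbove (p : ℝ) (x : Word → ℕ → ℝ) : Word → ℝ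
  | [] => p
  | some i :: v => x v i
  | none :: _ => 0

/-- The edge weights of the alternate tree where the root has a parent edge with point `p`. -/
def edgeWeightFrom (s : Bool) (z : ℂ) (p : ℝ) (x : Word → ℕ → ℝ) (k : Word) : Option ℕ → ℂ
  | some j => if kind s k then ((x k j / (pointAbove p x k + ∑' i, x k i) : ℝ) : ℂ)
      else (omegaHat x k j : ℂ)
  | none => if kind s k then -z else -conj z

open scoped Classical in
/-- The edge weights, set to `0` on the edges that do not belong to the tree. -/
def cutEdge (b s : Bool) (z : ℂ) (p : ℝ) (x : Word → ℕ → ℝ) (k : Word) (a : Option ℕ) : ℂ :=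
  if a :: k ∈ vertexSet b then edgeWeightFrom s z p x k a else 0

/-- The points of the subtree at the child `[a]` of the root. -/
def shift (a : Option ℕ) (x : Word → ℕ → ℝ) (k : Word) : ℕ → ℝ := x (k ++ [a])

/-- Points for which the alternate trees define self-adjoint operators. -/
structure IsRegular (x : Word → ℕ → ℝ) : Prop where
  nonneg : ∀ k j, 0 ≤ x k j
  summable : ∀ k, Summable (x k)
  summable_omegaHat : ∀ k, Summable fun j => omegaHat x k j ^ 2

lemma isRegular_shift {x : Word → ℕ → ℝ} (hx : IsRegular x) (a : Option ℕ) :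
    IsRegular (shift a x) :=
  ⟨fun _ => hx.nonneg _, fun _ => hx.summable _, fun k => hx.summable_omegaHat (k ++ [a])⟩

lemma parentPoint_eq (x : Word → ℕ → ℝ) (k : Word) : parentPoint x k = pointAbove 0 x k := by
  rcases k with _ | ⟨_ | i, v⟩ <;> rfl

lemma edgeWeight_eq (s : Bool) (z : ℂ) (x : Word → ℕ → ℝ) :
    edgeWeight s z x = edgeWeightFrom s z 0 x := by
  funext k a
  cases a with
  | none => rfl
  | some j => simp [edgeWeight, edgeWeightFrom, zetaHat, parentPoint_eq]

lemma kind_append (s : Bool) (k : Word) (a : Option ℕ) : kind s (k ++ [a]) = kind (!s) k := by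
  induction k with
  | nil => rfl
  | cons b k ih => simp [kind, ih]

lemma vertices_tail {a : Option ℕ} {k : Word} (h : a :: k ∈ vertices) : k ∈ vertices :=
  List.IsChain.tail h

lemma vertexSet_tail {b : Bool} {a : Option ℕ} {k : Word} (h : a :: k ∈ vertexSet b) :
    k ∈ vertexSet b := by
  cases b with
  | false => exact vertices_tail h
  | true =>
    obtain ⟨h1, h2⟩ := h
    refine ⟨vertices_tail h1, ?_⟩
    cases k with
    | nil => simp
    | cons c k => simpa [List.getLast?_cons_cons] using h2

lemma append_some_mem_vertices {k : Word} {j : ℕ} : k ++ [some j] ∈ vertices ↔ k ∈ vertices := by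
  simp [vertices, List.isChain_append]

lemma append_none_mem_vertices {k : Word} : k ++ [none] ∈ vertices ↔ k ∈ barVertices := by
  refine List.isChain_append.trans (and_congr_right fun _ => ?_)
  simp only [List.IsChain.singleton, true_and]
  constructor
  · intro h h2
    exact h none h2 none rfl ⟨rfl, rfl⟩
  · rintro h a ha b hb ⟨rfl, -⟩
    exact h ha

lemma append_some_mem_vertexSet {b : Bool} {k : Word} {j : ℕ} :
    k ++ [some j] ∈ vertexSet b ↔ k ∈ vertices := by
  cases b with
  | false => exact append_some_mem_vertices
  | true => simp [vertexSet, barVertices, append_some_mem_vertices]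

lemma some_mem_vertexSet (b : Bool) (j : ℕ) : [some j] ∈ vertexSet b :=
  append_some_mem_vertexSet (k := []).2 nil_mem_vertices

lemma nil_mem_vertexSet (b : Bool) : [] ∈ vertexSet b := vertexSet_tail (some_mem_vertexSet b 0)

lemma none_mem_vertexSet_iff (b : Bool) : [none] ∈ vertexSet b ↔ b = false := by
  cases b with
  | false => exact iff_of_true (append_none_mem_vertices (k := []).2 nil_mem_barVertices) rfl
  | true => simp [vertexSet, barVertices]

lemma pointAbove_shift (p : ℝ) (x : Word → ℕ → ℝ) (j : ℕ) (k : Word) :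
    pointAbove p x (k ++ [some j]) = pointAbove (x [] j) (shift (some j) x) k := by
  rcases k with _ | ⟨_ | i, v⟩ <;> rfl

lemma pointAbove_shift_none (p : ℝ) (x : Word → ℕ → ℝ) (k : Word) :
    pointAbove p x (k ++ [none]) = pointAbove 0 (shift none x) k := by
  rcases k with _ | ⟨_ | i, v⟩ <;> rfl

/-- Below an ordinary child the full tree of the opposite type reappears, also when the additional
child of the root was cut off. The parameter `p` becomes the point of the edge just descended. -/
lemma subtreeWeight_cutEdge_some (b s : Bool) (z : ℂ) (p : ℝ) (x : Word → ℕ → ℝ) (j : ℕ) :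
    subtree (cutEdge b s z p x) (some j) = cutEdge false (!s) z (x [] j) (shift (some j) x) := by
  funext k a
  have h : a :: (k ++ [some j]) ∈ vertexSet b ↔ a :: k ∈ vertexSet false :=
    append_some_mem_vertexSet (k := a :: k)
  have h2 : edgeWeightFrom s z p x (k ++ [some j]) a =
      edgeWeightFrom (!s) z (x [] j) (shift (some j) x) k a := by
    cases a
    · simp only [edgeWeightFrom, kind_append]
    · simp only [edgeWeightFrom, kind_append, pointAbove_shift]
      rfl
  simp only [subtree, cutEdge, h2]
  classical
  exact if_congr h rfl rfl

/-- A pending node has no additional child of its own, so its subtree is of the cut kind, and it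
starts a fresh copy, whence the point `0`. -/
lemma subtreeWeight_cutEdge_none (s : Bool) (z : ℂ) (p : ℝ) (x : Word → ℕ → ℝ) :
    subtree (cutEdge false s z p x) none = cutEdge true (!s) z 0 (shift none x) := by
  funext k a
  have h : a :: (k ++ [none]) ∈ vertexSet false ↔ a :: k ∈ vertexSet true :=
    append_none_mem_vertices (k := a :: k)
  have h2 : edgeWeightFrom s z p x (k ++ [none]) a =
      edgeWeightFrom (!s) z 0 (shift none x) k a := by
    cases a
    · simp only [edgeWeightFrom, kind_append]
    · simp only [edgeWeightFrom, kind_append, pointAbove_shift_none]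
      rfl
  simp only [subtree, cutEdge, h2]
  classical
  exact if_congr h rfl rfl

/-- The point above the root enters only through ζ̂ weights at the root, and a root of type -
carries ω̂ weights. This is why the recursion closes on `hRes false`. -/
lemma cutEdge_false_kind (b : Bool) (z : ℂ) (p : ℝ) (x : Word → ℕ → ℝ) :
    cutEdge b false z p x = cutEdge b false z 0 x := by
  funext k a
  unfold cutEdge
  congr 1
  rcases k with _ | ⟨_ | i, v⟩ <;> cases a <;> rfl

/-- The quotients lie in `[0, 1]` and sum to at most one, and squaring decreases them. This is the
uniform bound for ζ̂ edges. -/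
lemma div_add_tsum_le_one {f : ℕ → ℝ} (hf : ∀ j, 0 ≤ f j) (hs : Summable f) {p : ℝ} (hp : 0 ≤ p)
    (s : Finset ℕ) : ∑ j ∈ s, (f j / (p + ∑' i, f i)) ^ 2 ≤ 1 := by
  have hS : 0 ≤ ∑' i, f i := tsum_nonneg hf
  have h1 : ∀ j, f j / (p + ∑' i, f i) ≤ 1 := fun j => by
    refine div_le_one_of_le₀ ?_ (by positivity)
    have := hs.le_tsum j fun i _ => hf i
    linarith
  calc ∑ j ∈ s, (f j / (p + ∑' i, f i)) ^ 2 ≤ ∑ j ∈ s, f j / (p + ∑' i, f i) := by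
        refine Finset.sum_le_sum fun j _ => ?_
        have h0 : 0 ≤ f j / (p + ∑' i, f i) := div_nonneg (hf j) (by positivity)
        nlinarith [h1 j]
    _ = (∑ j ∈ s, f j) / (p + ∑' i, f i) := by rw [Finset.sum_div]
    _ ≤ 1 := by
        refine div_le_one_of_le₀ ?_ (by positivity)
        have := hs.sum_le_tsum s fun i _ => hf i
        linarith

lemma IsRegular.pointAbove_nonneg {x : Word → ℕ → ℝ} (hx : IsRegular x) {p : ℝ} (hp : 0 ≤ p)
    (k : Word) : 0 ≤ pointAbove p x k := by
  rcases k with _ | ⟨_ | i, v⟩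
  exacts [hp, le_rfl, hx.nonneg _ _]

lemma norm_cutEdge_le (b s : Bool) (z : ℂ) (p : ℝ) (x : Word → ℕ → ℝ) (k : Word) (a : Option ℕ) :
    ‖cutEdge b s z p x k a‖ ≤ ‖edgeWeightFrom s z p x k a‖ := by
  unfold cutEdge
  split_ifs
  · exact le_rfl
  · simp

/-- The strong edges are the ω̂ edges, from vertices of type - to ordinary children. In `K = 1 +
‖z‖²`, the `1` bounds the ζ̂ edges and `‖z‖²` is the edge to the additional child. Types alternate,
so two strong edges never follow each other. -/
theorem IsRegular.isTame {x : Word → ℕ → ℝ} (hx : IsRegular x) (b s : Bool) (z : ℂ) {p : ℝ}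
    (hp : 0 ≤ p) : IsTame (cutEdge b s z p x) := by
  have hle : ∀ k a, ‖cutEdge b s z p x k a‖ ^ 2 ≤ ‖edgeWeightFrom s z p x k a‖ ^ 2 := fun k a =>
    pow_le_pow_left₀ (norm_nonneg _) (norm_cutEdge_le b s z p x k a) 2
  have hnone : ∀ k, ‖edgeWeightFrom s z p x k none‖ ^ 2 = ‖z‖ ^ 2 := fun k => by
    unfold edgeWeightFrom
    split_ifs <;> simp
  have hplus : ∀ k, kind s k = true → ∀ t : Finset ℕ,
      ∑ j ∈ t, ‖edgeWeightFrom s z p x k (some j)‖ ^ 2 ≤ 1 := fun k hk t => by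
    refine le_trans (le_of_eq (Finset.sum_congr rfl fun j _ => ?_)) (div_add_tsum_le_one
      (hx.nonneg k) (hx.summable k) (hx.pointAbove_nonneg hp k) t)
    simp only [edgeWeightFrom, hk, if_true, Complex.norm_real, Real.norm_eq_abs, sq_abs]
  refine ⟨fun k => ?_, fun k a => kind s k = false ∧ a ≠ none, 1 + ‖z‖ ^ 2, fun k t ht => ?_,
    fun k a c h1 h2 => ?_⟩
  · refine Summable.of_nonneg_of_le (fun _ => sq_nonneg _) (hle k) ?_
    refine (hasSum_option (Summable.hasSum ?_)).summable
    by_cases hk : kind s k = true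
    · exact summable_of_sum_le (fun _ => sq_nonneg _) (hplus k hk)
    · refine (hx.summable_omegaHat k).congr fun j => ?_
      simp [edgeWeightFrom, hk]
  · refine (Finset.sum_le_sum fun a _ => hle k a).trans ?_
    classical
    by_cases hk : kind s k = true
    · calc ∑ a ∈ t, ‖edgeWeightFrom s z p x k a‖ ^ 2
          ≤ ∑ a ∈ t.eraseNone.insertNone, ‖edgeWeightFrom s z p x k a‖ ^ 2 := by
            refine Finset.sum_le_sum_of_subset_of_nonneg ?_ fun _ _ _ => sq_nonneg _
            rw [Finset.insertNone_eraseNone]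
            exact Finset.subset_insert _ _
        _ = ‖z‖ ^ 2 + ∑ j ∈ t.eraseNone, ‖edgeWeightFrom s z p x k (some j)‖ ^ 2 := by
            rw [Finset.sum_insertNone, hnone]
        _ ≤ 1 + ‖z‖ ^ 2 := by linarith [hplus k hk t.eraseNone]
    · have hsub : t ⊆ {none} := fun a ha => by
        have := ht a ha
        simpa [hk] using this
      calc ∑ a ∈ t, ‖edgeWeightFrom s z p x k a‖ ^ 2
          ≤ ∑ a ∈ {none}, ‖edgeWeightFrom s z p x k a‖ ^ 2 :=
            Finset.sum_le_sum_of_subset_of_nonneg hsub fun _ _ _ => sq_nonneg _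
        _ ≤ 1 + ‖z‖ ^ 2 := by rw [Finset.sum_singleton, hnone]; linarith
  · simp [kind, h1.1] at h2

lemma wordWeight_cutEdge {b s : Bool} {z : ℂ} {x : Word → ℕ → ℝ} {u v : Word}
    (hu : u ∈ vertexSet b) (hv : v ∈ vertexSet b) :
    wordWeight (cutEdge b s z 0 x) u v = treeWeight s z x u v := by
  unfold wordWeight treeWeight
  rw [edgeWeight_eq]
  congr 1
  · cases v with
    | nil => rfl
    | cons a k =>
      by_cases h : k = u
      · subst h
        simp [cutEdge, hv]
      · simp [h]
  · cases u with
    | nil => rfl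
    | cons a k =>
      by_cases h : k = v
      · subst h
        simp [cutEdge, hu]
      · simp [h]

lemma wordWeight_cutEdge_eq_zero {b s : Bool} {z : ℂ} {p : ℝ} {x : Word → ℕ → ℝ} :
    ∀ u ∈ vertexSet b, ∀ v ∉ vertexSet b, wordWeight (cutEdge b s z p x) u v = 0 := by
  intro u hu v hv
  have h1 : ∀ a, v = a :: u → cutEdge b s z p x u a = 0 := fun a h => if_neg (h ▸ hv)
  have h2 : ∀ a, u ≠ a :: v := fun a h => hv (vertexSet_tail (h ▸ hu))
  unfold wordWeight
  rcases v with _ | ⟨a, k⟩ <;> rcases u with _ | ⟨c, l⟩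
  · simp
  · have : l ≠ [] := fun h => h2 c (by rw [h])
    simp [this]
  · by_cases h : k = []
    · simp [h, h1 a (by rw [h])]
    · simp [h]
  · have h3 : l ≠ a :: k := fun h => h2 c (by rw [h])
    by_cases h : k = c :: l
    · simp [h1 a (by rw [h]), h3]
    · simp [h, h3]

lemma hatTree_eq (s : Bool) (z : ℂ) (x : Word → ℕ → ℝ) :
    hatTree s z x = fun u v : vertexSet false => wordWeight (cutEdge false s z 0 x) u v := by
  funext u v
  exact (wordWeight_cutEdge u.2 v.2).symm

lemma barTree_eq (s : Bool) (z : ℂ) (x : Word → ℕ → ℝ) :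
    barTree s z x = fun u v : vertexSet true => wordWeight (cutEdge true s z 0 x) u v := by
  funext u v
  exact (wordWeight_cutEdge u.2 v.2).symm

/-! ### Pathwise recursions for the resolvent entries of the alternate trees -/

variable {x : Word → ℕ → ℝ} {η z : ℂ}

lemma IsRegular.isDeterminate_hatTree (hx : IsRegular x) (s : Bool) (z : ℂ) :
    IsDeterminate (hatTree s z x) := by
  rw [hatTree_eq]
  exact (hx.isTame false s z le_rfl).isDeterminate.restrict wordWeight_cutEdge_eq_zero

lemma IsRegular.isDeterminate_barTree (hx : IsRegular x) (s : Bool) (z : ℂ) :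
    IsDeterminate (barTree s z x) := by
  rw [barTree_eq]
  exact (hx.isTame true s z le_rfl).isDeterminate.restrict wordWeight_cutEdge_eq_zero

lemma IsRegular.hRes_eq (hx : IsRegular x) (hη : 0 < η.im) (s : Bool) :
    hRes s η z x = treeRes (cutEdge false s z 0 x) η := by
  unfold hRes
  rw [hatTree_eq]
  exact (hx.isTame false s z le_rfl).isDeterminate.rootResolvent_restrict
    wordWeight_cutEdge_eq_zero (nil_mem_vertexSet false) hη.ne'

lemma IsRegular.hBar_eq (hx : IsRegular x) (hη : 0 < η.im) (s : Bool) :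
    hBar s η z x = treeRes (cutEdge true s z 0 x) η := by
  unfold hBar
  rw [barTree_eq]
  exact (hx.isTame true s z le_rfl).isDeterminate.rootResolvent_restrict
    wordWeight_cutEdge_eq_zero (nil_mem_vertexSet true) hη.ne'

lemma IsRegular.hBar_im_pos (hx : IsRegular x) (hη : 0 < η.im) (s : Bool) :
    0 < (hBar s η z x).im := by
  rw [hx.hBar_eq hη]
  exact (hx.isTame true s z le_rfl).treeRes_im_pos hη

/-- The sum over the ordinary children of the root in the recursion. -/
def childSum (s : Bool) (η z : ℂ) (p : ℝ) (x : Word → ℕ → ℝ) : ℂ :=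
  ∑' j, (‖edgeWeightFrom s z p x [] (some j)‖ : ℂ) ^ 2 *
    treeRes (cutEdge false (!s) z (x [] j) (shift (some j) x)) η

lemma IsRegular.summable_childSum (hx : IsRegular x) (hη : 0 < η.im) (s : Bool) {p : ℝ}
    (hp : 0 ≤ p) : Summable fun j => (‖edgeWeightFrom s z p x [] (some j)‖ : ℂ) ^ 2 *
      treeRes (cutEdge false (!s) z (x [] j) (shift (some j) x)) η := by
  have h1 := ((hx.isTame false s z hp).1 []).comp_injective (Option.some_injective ℕ)
  refine Summable.of_norm_bounded (h1.mul_right η.im⁻¹) fun j => ?_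
  rw [norm_mul, norm_pow, Complex.norm_real, norm_norm]
  have h2 : cutEdge false s z p x [] (some j) = edgeWeightFrom s z p x [] (some j) :=
    if_pos (some_mem_vertexSet false j)
  rw [Function.comp_apply, h2]
  exact mul_le_mul_of_nonneg_left
    (((isRegular_shift hx (some j)).isTame false (!s) z (hx.nonneg [] j)).norm_treeRes_le hη) (sq_nonneg _)

lemma IsRegular.treeRes_true_eq (hx : IsRegular x) (hη : 0 < η.im) (s : Bool) {p : ℝ}
    (hp : 0 ≤ p) : treeRes (cutEdge true s z p x) η = psi η (childSum s η z p x) := by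
  rw [(hx.isTame true s z hp).treeRes_eq hη]
  congr 1
  have hnone : cutEdge true s z p x [] none = 0 :=
    if_neg fun h => by simp [none_mem_vertexSet_iff] at h
  have hs := hasSum_option (f := fun a => (‖cutEdge true s z p x [] a‖ : ℂ) ^ 2 *
    treeRes (subtree (cutEdge true s z p x) a) η) (s := childSum s η z p x) (by
      refine (hx.summable_childSum hη s hp).hasSum.congr_fun fun j => ?_
      rw [subtreeWeight_cutEdge_some]
      congr 3
      exact congrArg norm (if_pos (some_mem_vertexSet true j)))
  rw [hs.tsum_eq, hnone]
  simp

lemma IsRegular.treeRes_false_eq (hx : IsRegular x) (hη : 0 < η.im) (s : Bool) {p : ℝ}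
    (hp : 0 ≤ p) : treeRes (cutEdge false s z p x) η =
      psi η ((‖z‖ : ℂ) ^ 2 * hBar (!s) η z (shift none x) + childSum s η z p x) := by
  rw [(hx.isTame false s z hp).treeRes_eq hη]
  congr 1
  have hnone : ‖cutEdge false s z p x [] none‖ = ‖z‖ := by
    have : cutEdge false s z p x [] none = edgeWeightFrom s z p x [] none :=
      if_pos ((none_mem_vertexSet_iff false).2 rfl)
    rw [this]
    unfold edgeWeightFrom
    split_ifs <;> simp
  have hs := hasSum_option (f := fun a => (‖cutEdge false s z p x [] a‖ : ℂ) ^ 2 *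
    treeRes (subtree (cutEdge false s z p x) a) η) (s := childSum s η z p x) (by
      refine (hx.summable_childSum hη s hp).hasSum.congr_fun fun j => ?_
      rw [subtreeWeight_cutEdge_some]
      congr 3
      exact congrArg norm (if_pos (some_mem_vertexSet false j)))
  rw [hs.tsum_eq, hnone, subtreeWeight_cutEdge_none, (isRegular_shift hx none).hBar_eq hη]

lemma norm_ofReal_sq (r : ℝ) : (‖(r : ℂ)‖ : ℂ) ^ 2 = (r : ℂ) ^ 2 := by
  rw [Complex.norm_real, Real.norm_eq_abs, ← Complex.ofReal_pow, sq_abs, Complex.ofReal_pow]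

lemma IsRegular.childSum_true_term (hx : IsRegular x) (hη : 0 < η.im) (p : ℝ) (j : ℕ) :
    (‖edgeWeightFrom true z p x [] (some j)‖ : ℂ) ^ 2 *
      treeRes (cutEdge false (!true) z (x [] j) (shift (some j) x)) η =
    ((x [] j / (p + ∑' i, x [] i) : ℝ) : ℂ) ^ 2 * hRes false η z (shift (some j) x) := by
  rw [(isRegular_shift hx _).hRes_eq hη, Bool.not_true, cutEdge_false_kind,
    ← norm_ofReal_sq (x [] j / (p + ∑' i, x [] i))]
  rfl

lemma IsRegular.childSum_true (hx : IsRegular x) (hη : 0 < η.im) (p : ℝ) :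
    childSum true η z p x =
    ∑' j, ((x [] j / (p + ∑' i, x [] i) : ℝ) : ℂ) ^ 2 * hRes false η z (shift (some j) x) :=
  tsum_congr fun j => hx.childSum_true_term hη p j

lemma IsRegular.summable_childSum_true (hx : IsRegular x) (hη : 0 < η.im) {p : ℝ} (hp : 0 ≤ p) :
    Summable fun j => ((x [] j / (p + ∑' i, x [] i) : ℝ) : ℂ) ^ 2 *
      hRes false η z (shift (some j) x) :=
  (hx.summable_childSum hη true hp).congr fun j => (hx.childSum_true_term hη p j)

/-- The child has type + and depends on the point above it, so the recursion is unfolded once more;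
the grandchildren are again of type -. -/
lemma IsRegular.childSum_false_term (hx : IsRegular x) (hη : 0 < η.im) (p : ℝ) (k : ℕ) :
    (‖edgeWeightFrom false z p x [] (some k)‖ : ℂ) ^ 2 *
      treeRes (cutEdge false (!false) z (x [] k) (shift (some k) x)) η =
    (outerWeight (x []) (fun k => x [some k]) k : ℂ) ^ 2 *
      psi η ((‖z‖ : ℂ) ^ 2 * hBar false η z (shift none (shift (some k) x)) +
        ∑' j, (innerWeight (x []) (fun k => x [some k]) k j : ℂ) ^ 2 *
          hRes false η z (shift (some j) (shift (some k) x))) := by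
  rw [Bool.not_false, (isRegular_shift hx _).treeRes_false_eq hη _ (hx.nonneg [] k),
    (isRegular_shift hx _).childSum_true hη,
    ← norm_ofReal_sq (outerWeight (x []) (fun k => x [some k]) k)]
  rfl

lemma IsRegular.childSum_false (hx : IsRegular x) (hη : 0 < η.im) (p : ℝ) :
    childSum false η z p x =
    ∑' k, (outerWeight (x []) (fun k => x [some k]) k : ℂ) ^ 2 *
      psi η ((‖z‖ : ℂ) ^ 2 * hBar false η z (shift none (shift (some k) x)) +
        ∑' j, (innerWeight (x []) (fun k => x [some k]) k j : ℂ) ^ 2 *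
          hRes false η z (shift (some j) (shift (some k) x))) :=
  tsum_congr fun k => hx.childSum_false_term hη p k

lemma IsRegular.summable_childSum_false (hx : IsRegular x) (hη : 0 < η.im) :
    Summable fun k => (outerWeight (x []) (fun k => x [some k]) k : ℂ) ^ 2 *
      psi η ((‖z‖ : ℂ) ^ 2 * hBar false η z (shift none (shift (some k) x)) +
        ∑' j, (innerWeight (x []) (fun k => x [some k]) k j : ℂ) ^ 2 *
          hRes false η z (shift (some j) (shift (some k) x))) :=
  (hx.summable_childSum hη false le_rfl).congr fun k => (hx.childSum_false_term hη 0 k)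

lemma IsRegular.summable_innerWeight (hx : IsRegular x) (hη : 0 < η.im) (k : ℕ) :
    Summable fun j => (innerWeight (x []) (fun k => x [some k]) k j : ℂ) ^ 2 *
      hRes false η z (shift (some j) (shift (some k) x)) :=
  (isRegular_shift hx (some k)).summable_childSum_true hη (hx.nonneg [] k)

lemma IsRegular.hBar_eq_psi (hx : IsRegular x) (hη : 0 < η.im) (s : Bool) :
    hBar s η z x = psi η (childSum s η z 0 x) := by
  rw [hx.hBar_eq hη, hx.treeRes_true_eq hη s le_rfl]

lemma IsRegular.hRes_eq_psi (hx : IsRegular x) (hη : 0 < η.im) (s : Bool) :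
    hRes s η z x =
      psi η ((‖z‖ : ℂ) ^ 2 * hBar (!s) η z (shift none x) + childSum s η z 0 x) := by
  rw [hx.hRes_eq hη, hx.treeRes_false_eq hη s le_rfl]

/-- Otherwise `r * c = b⁻¹`, but the left side has nonnegative and the right side negative imaginary
part. -/
lemma one_sub_mul_ne_zero {b c r : ℂ} (hb : 0 < b.im) (hc : 0 < c.im) (hr : 0 ≤ r.re)
    (hr' : r.im = 0) : 1 - r * b * c ≠ 0 := by
  intro h
  have hb0 : b ≠ 0 := fun h => by simp [h] at hb
  have h1 : r * c = b⁻¹ := by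
    field_simp
    linear_combination -h
  have h2 := congrArg Complex.im h1
  rw [Complex.mul_im, hr', Complex.inv_im] at h2
  have h3 : -b.im / Complex.normSq b < 0 :=
    div_neg_of_neg_of_pos (by linarith) (Complex.normSq_pos.2 hb0)
  nlinarith [mul_nonneg hr hc.le]

/-- The two recursions at the root differ only by the term of the additional child, so the common
sum over ordinary children can be eliminated. -/
lemma IsRegular.hRes_eq_div (hx : IsRegular x) (hη : 0 < η.im) (s : Bool) :
    hRes s η z x = hBar s η z x /
      (1 - (‖z‖ : ℂ) ^ 2 * hBar s η z x * hBar (!s) η z (shift none x)) := by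
  have h1 := hx.hBar_im_pos hη s (z := z)
  have h2 := (isRegular_shift hx none).hBar_im_pos hη (!s) (z := z)
  have h3 := one_sub_mul_ne_zero h1 h2 (r := (‖z‖ : ℂ) ^ 2) (by
    rw [← Complex.ofReal_pow, Complex.ofReal_re]; positivity) (by
    rw [← Complex.ofReal_pow, Complex.ofReal_im])
  have h0 : hBar s η z x ≠ 0 := fun h => by simp [h] at h1
  rw [hx.hRes_eq_psi hη]
  have h4 : hBar s η z x = -(η + childSum s η z 0 x)⁻¹ := hx.hBar_eq_psi hη s
  set b := hBar s η z x
  set c := hBar (!s) η z (shift none x)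
  have h5 : η + childSum s η z 0 x = -b⁻¹ := by rw [h4]; simp
  rw [psi, show η + ((‖z‖ : ℂ) ^ 2 * c + childSum s η z 0 x) =
    (η + childSum s η z 0 x) + (‖z‖ : ℂ) ^ 2 * c by ring, h5]
  have h6 : -b⁻¹ + (‖z‖ : ℂ) ^ 2 * c = -((1 - (‖z‖ : ℂ) ^ 2 * b * c) / b) := by
    field_simp
    ring
  rw [h6, inv_neg, neg_neg, inv_div]

end

section

open Filter Topology

/-! ### Almost sure properties of PPP(α) -/

instance isProbabilityMeasure_expMeasure_one : IsProbabilityMeasure (expMeasure 1) :=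
  isProbabilityMeasure_expMeasure one_pos

lemma ae_pos_expMeasure : ∀ᵐ t ∂expMeasure 1, 0 < t := by
  have h : expMeasure 1 (Set.Iic 0) = 0 := by
    rw [← ofReal_cdf, cdf_expMeasure_eq one_pos]
    simp
  rw [ae_iff]
  convert h using 2
  ext t
  simp

lemma lintegral_rpow_expMeasure_lt_top {s : ℝ} (hs : 0 ≤ s) :
    ∫⁻ t, ENNReal.ofReal (t ^ s) ∂expMeasure 1 < ∞ := by
  have h1 : expMeasure 1 = volume.withDensity (exponentialPDF 1) := rfl
  have hm : Measurable (exponentialPDF 1) := (measurable_exponentialPDFReal 1).ennreal_ofReal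
  rw [h1, lintegral_withDensity_eq_lintegral_mul _ hm (by fun_prop)]
  have h2 : ∀ t : ℝ, (exponentialPDF 1 * fun t => ENNReal.ofReal (t ^ s)) t =
      (Set.Ici 0).indicator (fun t => ENNReal.ofReal (Real.exp (-t) * t ^ (s + 1 - 1))) t := by
    intro t
    by_cases ht : 0 ≤ t
    · rw [Set.indicator_of_mem (Set.mem_Ici.2 ht), Pi.mul_apply, exponentialPDF_of_nonneg ht,
        ← ENNReal.ofReal_mul (by positivity)]
      simp
    · rw [Set.indicator_of_notMem (by simpa using ht), Pi.mul_apply,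
        exponentialPDF_of_neg (not_le.1 ht), zero_mul]
  simp_rw [h2]
  rw [lintegral_indicator measurableSet_Ici, ← setLIntegral_congr Ioi_ae_eq_Ici]
  exact (Real.GammaIntegral_convergent (by linarith)).lintegral_lt_top

lemma integrable_id_expMeasure : Integrable (fun t : ℝ => t) (expMeasure 1) := by
  refine ⟨by fun_prop, ?_⟩
  rw [hasFiniteIntegral_iff_norm]
  refine lt_of_eq_of_lt (lintegral_congr_ae ?_) (lintegral_rpow_expMeasure_lt_top zero_le_one)
  filter_upwards [ae_pos_expMeasure] with t ht
  rw [Real.rpow_one, Real.norm_of_nonneg ht.le]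

lemma integral_id_expMeasure_pos : 0 < ∫ t, t ∂expMeasure 1 := by
  rw [integral_pos_iff_support_of_nonneg_ae _ integrable_id_expMeasure]
  · refine pos_iff_ne_zero.2 fun h => ?_
    have h1 : ∀ᵐ t ∂expMeasure 1, t = 0 := by
      rw [ae_iff]
      exact h
    have h2 : ∀ᵐ t : ℝ ∂expMeasure 1, False := by
      filter_upwards [h1, ae_pos_expMeasure] with t h1 h2
      exact absurd h1 h2.ne'
    simp [IsProbabilityMeasure.ne_zero] at h2
  · filter_upwards [ae_pos_expMeasure] with t ht using ht.le

lemma ae_pos_waiting : ∀ᵐ E ∂(Measure.infinitePi fun _ : ℕ => expMeasure 1), ∀ i, 0 < E i :=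
  ae_all_iff.2 fun i => (measurePreserving_eval_infinitePi
    (fun _ : ℕ => expMeasure 1) i).quasiMeasurePreserving.ae ae_pos_expMeasure

/-- By the strong law of large numbers the arrival times grow linearly, so these ratios converge and
are bounded. -/
lemma ae_exists_arrival_ge : ∀ᵐ E ∂(Measure.infinitePi fun _ : ℕ => expMeasure 1),
    ∃ B : ℝ, ∀ n : ℕ, ((n + 1 : ℕ) : ℝ) / ∑ i ∈ Finset.range (n + 1), E i ≤ B := by
  have hmp := measurePreserving_eval_infinitePi (fun _ : ℕ => expMeasure 1)
  have hint : Integrable (fun E : ℕ → ℝ => E 0) (Measure.infinitePi fun _ : ℕ => expMeasure 1) :=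
    (hmp 0).integrable_comp_of_integrable integrable_id_expMeasure
  have hindep : iIndepFun (fun (i : ℕ) (E : ℕ → ℝ) => E i)
      (Measure.infinitePi fun _ : ℕ => expMeasure 1) :=
    iIndepFun_infinitePi (X := fun _ t => t) fun _ => measurable_id
  have hslln := strong_law_ae_real (fun (i : ℕ) (E : ℕ → ℝ) => E i) hint
    (fun i j hij => hindep.indepFun hij)
    (fun i => ⟨(hmp i).measurable.aemeasurable, (hmp 0).measurable.aemeasurable,
      (hmp i).map_eq.trans (hmp 0).map_eq.symm⟩)
  have hmean : 0 < ∫ E : ℕ → ℝ, E 0 ∂(Measure.infinitePi fun _ : ℕ => expMeasure 1) := by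
    have h := integral_map (μ := Measure.infinitePi fun _ : ℕ => expMeasure 1) (hmp 0).measurable.aemeasurable
      (f := fun t : ℝ => t) (by fun_prop)
    rw [(hmp 0).map_eq] at h
    exact h ▸ integral_id_expMeasure_pos
  filter_upwards [hslln] with E hE
  have h1 := ((hE.inv₀ hmean.ne').comp (tendsto_add_atTop_nat 1)).bddAbove_range
  obtain ⟨B, hB⟩ := h1
  refine ⟨B, fun n => ?_⟩
  have := hB ⟨n, rfl⟩
  simpa using this

/-- The points of PPP(α) are positive and decay like `n ^ (-1/α)`. -/
def HasDecay (α : ℝ) (x : ℕ → ℝ) : Prop :=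
  (∀ n, 0 < x n) ∧ ∃ M : ℕ, ∀ n : ℕ, x n ≤ M * ((n + 1 : ℕ) : ℝ) ^ (-1 / α)

/-- The constant `M` ranges over the natural numbers, which makes the existential a countable union.
-/
lemma measurableSet_hasDecay (α : ℝ) : MeasurableSet {x | HasDecay α x} := by
  unfold HasDecay
  measurability

lemma ae_hasDecay {α : ℝ} (hα : 0 < α) : ∀ᵐ x ∂pppLaw α, HasDecay α x := by
  rw [pppLaw, ae_map_iff (measurable_rankedPoints α).aemeasurable (measurableSet_hasDecay α)]
  filter_upwards [ae_pos_waiting, ae_exists_arrival_ge] with E hE ⟨B, hB⟩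
  have hS : ∀ n, 0 < ∑ i ∈ Finset.range (n + 1), E i := fun n =>
    Finset.sum_pos (fun i _ => hE i) (by simp)
  refine ⟨fun n => Real.rpow_pos_of_pos (hS n) _, ?_⟩
  have hB0 : 0 < B := (div_pos (by positivity) (hS 0)).trans_le (hB 0)
  obtain ⟨M, hM⟩ := exists_nat_ge (B ^ (1 / α))
  refine ⟨M, fun n => ?_⟩
  have h1 : ((n + 1 : ℕ) : ℝ) / B ≤ ∑ i ∈ Finset.range (n + 1), E i := by
    rw [div_le_iff₀ hB0, mul_comm, ← div_le_iff₀ (hS n)]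
    exact hB n
  have hexp : -1 / α ≤ 0 := div_nonpos_of_nonpos_of_nonneg (by norm_num) hα.le
  calc rankedPoints α E n ≤ (((n + 1 : ℕ) : ℝ) / B) ^ (-1 / α) :=
        Real.rpow_le_rpow_of_nonpos (by positivity) h1 hexp
    _ = B ^ (1 / α) * ((n + 1 : ℕ) : ℝ) ^ (-1 / α) := by
        rw [Real.div_rpow (by positivity) hB0.le, div_eq_mul_inv, mul_comm, ← Real.rpow_neg hB0.le]
        congr 2
        ring
    _ ≤ _ := mul_le_mul_of_nonneg_right hM (by positivity)

lemma summable_decay {α : ℝ} (hα : 0 < α ∧ α < 1) :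
    Summable fun n : ℕ => ((n + 1 : ℕ) : ℝ) ^ (-1 / α) := by
  refine (summable_nat_add_iff (f := fun n : ℕ => (n : ℝ) ^ (-1 / α)) 1).2
    (Real.summable_nat_rpow.2 ?_)
  rw [div_lt_iff₀ hα.1]
  linarith [hα.2]

lemma HasDecay.summable {α : ℝ} (hα : 0 < α ∧ α < 1) {x : ℕ → ℝ} (hx : HasDecay α x) :
    Summable x := by
  obtain ⟨h0, M, hM⟩ := hx
  exact Summable.of_nonneg_of_le (fun n => (h0 n).le) hM ((summable_decay hα).mul_left _)

/-- The inverse of the largest point is the first waiting time to the power `1 / α`, whose mean is a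
Gamma integral. -/
lemma lintegral_inv_pppLaw_lt_top {α : ℝ} (hα : 0 < α) :
    ∫⁻ x, ENNReal.ofReal (x 0)⁻¹ ∂pppLaw α < ∞ := by
  rw [pppLaw, lintegral_map (by fun_prop) (measurable_rankedPoints α)]
  have h1 : ∫⁻ E : ℕ → ℝ, ENNReal.ofReal (E 0 ^ (1 / α))
      ∂(Measure.infinitePi fun _ : ℕ => expMeasure 1) < ∞ := by
    rw [(measurePreserving_eval_infinitePi (fun _ : ℕ => expMeasure 1) 0).lintegral_comp
      (f := fun t => ENNReal.ofReal (t ^ (1 / α))) (by fun_prop)]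
    exact lintegral_rpow_expMeasure_lt_top (by positivity)
  refine lt_of_eq_of_lt (lintegral_congr_ae ?_) h1
  filter_upwards [ae_pos_waiting] with E hE
  congr 1
  rw [rankedPoints, Finset.sum_range_one, ← Real.rpow_neg (hE 0).le]
  congr 1
  ring

/-! ### Almost sure regularity of the points -/

/-- The law of the points: independent sequences with law PPP(α). -/
def fieldLaw (α : ℝ) : Measure (Word → ℕ → ℝ) := Measure.infinitePi fun _ => pppLaw α

instance isProbabilityMeasure_fieldLaw (α : ℝ) : IsProbabilityMeasure (fieldLaw α) := by
  unfold fieldLaw; infer_instance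

lemma measurePreserving_eval_fieldLaw (α : ℝ) (k : Word) :
    MeasurePreserving (fun x : Word → ℕ → ℝ => x k) (fieldLaw α) (pppLaw α) :=
  measurePreserving_eval_infinitePi _ k

lemma ae_hasDecay_fieldLaw {α : ℝ} (hα : 0 < α) : ∀ᵐ x ∂fieldLaw α, ∀ k, HasDecay α (x k) :=
  ae_all_iff.2 fun k => (measurePreserving_eval_fieldLaw α k).quasiMeasurePreserving.ae
    (ae_hasDecay hα)

/-- The weights are deterministic and summable and the means are equal and finite, so the
expectation of the sum is finite. -/
lemma ae_summable_div_fieldLaw {α : ℝ} (hα : 0 < α ∧ α < 1) :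
    ∀ᵐ x ∂fieldLaw α, ∀ k : Word, ∑' j : ℕ,
      ENNReal.ofReal (((j + 1 : ℕ) : ℝ) ^ (-1 / α)) *
        ENNReal.ofReal (x (some j :: k) 0)⁻¹ < ∞ := by
  refine ae_all_iff.2 fun k => ae_lt_top (by fun_prop) ?_
  rw [lintegral_tsum (fun j => Measurable.aemeasurable (by fun_prop))]
  have h1 : ∀ j : ℕ, ∫⁻ x, ENNReal.ofReal (((j + 1 : ℕ) : ℝ) ^ (-1 / α)) *
      ENNReal.ofReal (x (some j :: k) 0)⁻¹ ∂fieldLaw α =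
      ENNReal.ofReal (((j + 1 : ℕ) : ℝ) ^ (-1 / α)) *
        ∫⁻ x, ENNReal.ofReal (x 0)⁻¹ ∂pppLaw α := fun j => by
    rw [lintegral_const_mul _ (by fun_prop), (measurePreserving_eval_fieldLaw α
      (some j :: k)).lintegral_comp (f := fun x : ℕ → ℝ => ENNReal.ofReal (x 0)⁻¹) (by fun_prop)]
  simp_rw [h1]
  rw [ENNReal.tsum_mul_right]
  refine ENNReal.mul_ne_top ?_ (lintegral_inv_pppLaw_lt_top hα.1).ne
  exact (summable_decay hα).tsum_ofReal_ne_top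

/-- Since ω̂ lies in `[0, 1]`, its square is at most ω̂, which is at most the point of the edge
divided by the largest point of the child. The former decays like `(j + 1) ^ (-1 / α)` up to a
random constant. -/
theorem ae_isRegular {α : ℝ} (hα : 0 < α ∧ α < 1) : ∀ᵐ x ∂fieldLaw α, IsRegular x := by
  filter_upwards [ae_hasDecay_fieldLaw hα.1, ae_summable_div_fieldLaw hα] with x hx hx'
  have hsum := fun k => (hx k).summable hα
  refine ⟨fun k j => ((hx k).1 j).le, hsum, fun k => ?_⟩
  obtain ⟨h0, M, hM⟩ := hx k
  have h1 := (ENNReal.summable_toReal (hx' k).ne).mul_left (M : ℝ)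
  refine Summable.of_nonneg_of_le (fun j => sq_nonneg _) (fun j => ?_) h1
  have hS : x (some j :: k) 0 ≤ ∑' i, x (some j :: k) i :=
    (hsum _).le_tsum 0 fun i _ => ((hx _).1 i).le
  have hx0 := (hx (some j :: k)).1 0
  have hxk := h0 j
  have hω0 : 0 ≤ omegaHat x k j := by
    unfold omegaHat
    exact div_nonneg hxk.le (by linarith)
  have hω1 : omegaHat x k j ≤ 1 := div_le_one_of_le₀ (by linarith) (by linarith)
  have hω2 : omegaHat x k j ≤ x k j * (x (some j :: k) 0)⁻¹ := by
    rw [← div_eq_mul_inv]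
    exact div_le_div_of_nonneg_left hxk.le hx0 (by linarith)
  rw [ENNReal.toReal_mul, ENNReal.toReal_ofReal (by positivity),
    ENNReal.toReal_ofReal (by positivity), ← mul_assoc]
  calc omegaHat x k j ^ 2 ≤ omegaHat x k j := by nlinarith
    _ ≤ x k j * (x (some j :: k) 0)⁻¹ := hω2
    _ ≤ _ := mul_le_mul_of_nonneg_right (hM j) (by positivity)

end

section

/-! ### Measurability of the resolvent entries -/

section Measurability

open Filter Topology TopologicalSpace

variable {V : Type*} {w : V → V → ℂ}

open scoped Classical in
/-- The coordinates of `(w - η) a - δ_o`, where `a` is the finitely supported vector with the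
coefficients listed in `l` (in terms of a dense sequence of complex numbers). -/
def defectAt (w : V → V → ℂ) (η : ℂ) (o : V) (l : List (V × ℕ)) (u : V) : ℂ :=
  (l.map fun p => denseSeq ℂ p.2 * (w u p.1 - η * if u = p.1 then 1 else 0)).sum -
    if u = o then 1 else 0

/-- The square of the norm of `(w - η) a - δ_o`. -/
def defect (w : V → V → ℂ) (η : ℂ) (o : V) (l : List (V × ℕ)) : ℝ≥0∞ :=
  ∑' u, ENNReal.ofReal (‖defectAt w η o l u‖ ^ 2)

open scoped Classical in
/-- The coordinate at `o` of the vector with coefficients `l`. -/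
def coefAt (o : V) (l : List (V × ℕ)) : ℂ :=
  (l.map fun p => denseSeq ℂ p.2 * if o = p.1 then 1 else 0).sum

/-- The operator `w - η` on finitely supported vectors. -/
def shiftedAdjacency (w : V → V → ℂ) (η : ℂ) :
    (adjacency w).domain →ₗ[ℂ] lp (fun _ : V => ℂ) 2 :=
  (adjacency w).toFun - η • (adjacency w).domain.subtype

open scoped Classical in
/-- The basis vectors as elements of the domain. -/
def domainSingle (hw : IsDeterminate w) (v : V) : (adjacency w).domain :=
  ⟨lp.single 2 v 1, single_mem_domain hw.col v 1⟩

open scoped Classical in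
lemma domainSingle_apply (hw : IsDeterminate w) (v u : V) :
    (domainSingle hw v : lp (fun _ : V => ℂ) 2) u = if u = v then 1 else 0 :=
  single_apply_eq_ite v 1 u

open scoped Classical in
lemma shiftedAdjacency_domainSingle (hw : IsDeterminate w) (η : ℂ) (v u : V) :
    shiftedAdjacency w η (domainSingle hw v) u = w u v - η * if u = v then 1 else 0 := by
  rw [← domainSingle_apply hw]
  change adjacency w (domainSingle hw v) u - _ = _
  congr 1
  rw [adjacency_apply]
  exact (finsum_mul_single (fun v => w u v) v 1).trans (mul_one _)

/-- The vector with coefficients `l`. -/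
def listVector (hw : IsDeterminate w) (l : List (V × ℕ)) : (adjacency w).domain :=
  (l.map fun p => denseSeq ℂ p.2 • domainSingle hw p.1).sum

lemma listVector_apply (hw : IsDeterminate w) (l : List (V × ℕ)) (o : V) :
    (listVector hw l : lp (fun _ : V => ℂ) 2) o = coefAt o l := by
  classical
  induction l with
  | nil => rfl
  | cons p l ih =>
    have h1 : (listVector hw (p :: l) : lp (fun _ : V => ℂ) 2) o =
      denseSeq ℂ p.2 * (domainSingle hw p.1 : lp (fun _ : V => ℂ) 2) o +
        (listVector hw l : lp (fun _ : V => ℂ) 2) o := by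
      unfold listVector
      rw [List.map_cons, List.sum_cons]
      rfl
    rw [h1, ih, domainSingle_apply]
    simp only [coefAt, List.map_cons, List.sum_cons]

open scoped Classical in
lemma shiftedAdjacency_listVector (hw : IsDeterminate w) (η : ℂ) (o : V) (l : List (V × ℕ)) (u : V) :
    (shiftedAdjacency w η (listVector hw l) - lp.single 2 o 1 : lp (fun _ : V => ℂ) 2) u =
      defectAt w η o l u := by
  change shiftedAdjacency w η (listVector hw l) u -
    (lp.single 2 o 1 : lp (fun _ : V => ℂ) 2) u = _
  rw [single_apply_eq_ite, defectAt]
  congr 1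
  induction l with
  | nil =>
    simp only [listVector, List.map_nil, List.sum_nil, map_zero]
    rfl
  | cons p l ih =>
    have h1 : shiftedAdjacency w η (listVector hw (p :: l)) u =
      denseSeq ℂ p.2 * shiftedAdjacency w η (domainSingle hw p.1) u +
        shiftedAdjacency w η (listVector hw l) u := by
      unfold listVector
      rw [List.map_cons, List.sum_cons, map_add, map_smul]
      rfl
    rw [h1, ih, shiftedAdjacency_domainSingle, List.map_cons, List.sum_cons]

open scoped Classical in
lemma defect_eq (hw : IsDeterminate w) (η : ℂ) (o : V) (l : List (V × ℕ)) :
    defect w η o l =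
      ENNReal.ofReal (‖shiftedAdjacency w η (listVector hw l) - lp.single 2 o 1‖ ^ 2) := by
  have h := lp.norm_rpow_eq_tsum (p := 2) (by norm_num)
    (shiftedAdjacency w η (listVector hw l) - lp.single 2 o 1 : lp (fun _ : V => ℂ) 2)
  simp only [ENNReal.toReal_ofNat, Real.rpow_two] at h
  rw [h, ENNReal.ofReal_tsum_of_nonneg (fun _ => sq_nonneg _) (summable_norm_sq _)]
  simp_rw [shiftedAdjacency_listVector]
  rfl

lemma eq_sum_domainSingle (hw : IsDeterminate w) (a : (adjacency w).domain) :
    a = ∑ v ∈ a.2.1.toFinset, (a : lp (fun _ : V => ℂ) 2) v • domainSingle hw v := by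
  classical
  apply Subtype.ext
  ext u
  rw [AddSubmonoidClass.coe_finsetSum, lp.coeFn_sum, Finset.sum_apply]
  have h1 : ∀ v, ((((a : lp (fun _ : V => ℂ) 2) v • domainSingle hw v :
      (adjacency w).domain) : lp (fun _ : V => ℂ) 2)) u =
      (a : lp (fun _ : V => ℂ) 2) v * if u = v then 1 else 0 := fun v => by
    rw [← domainSingle_apply hw]
    rfl
  simp_rw [h1]
  simp only [mul_ite, mul_one, mul_zero, Finset.sum_ite_eq, Set.Finite.mem_toFinset,
    Function.mem_support]
  by_cases h : (a : lp (fun _ : V => ℂ) 2) u = 0 <;> simp [h]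

/-- The operator may be unbounded, so the finitely many coefficients are approximated one by one,
with the support fixed. -/
lemma shiftedAdjacency_mem_closure (hw : IsDeterminate w) (η : ℂ) (a : (adjacency w).domain) :
    shiftedAdjacency w η a ∈
      closure (Set.range fun l => shiftedAdjacency w η (listVector hw l)) := by
  rw [eq_sum_domainSingle hw a, map_sum]
  refine Finset.sum_induction _ (· ∈ closure (Set.range fun l =>
    shiftedAdjacency w η (listVector hw l))) (fun x y hx hy => ?_) ?_ fun v _ => ?_
  · refine map_mem_closure₂ continuous_add hx hy ?_
    rintro _ ⟨l, rfl⟩ _ ⟨l', rfl⟩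
    refine ⟨l ++ l', ?_⟩
    simp [listVector]
  · exact subset_closure ⟨[], by simp [listVector]⟩
  · rw [map_smul]
    have hc : Continuous fun c : ℂ => c • shiftedAdjacency w η (domainSingle hw v) := by fun_prop
    refine map_mem_closure (f := fun c : ℂ => c • shiftedAdjacency w η (domainSingle hw v)) hc
      ((denseRange_denseSeq ℂ) ((a : lp (fun _ : V => ℂ) 2) v)) ?_
    rintro _ ⟨n, rfl⟩
    exact ⟨[(v, n)], by simp [listVector]⟩

open scoped Classical in
lemma exists_defect_lt (hw : IsDeterminate w) {η : ℂ} (hη : η.im ≠ 0) (o : V) {ε : ℝ}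
    (hε : 0 < ε) : ∃ l, defect w η o l < ENNReal.ofReal (ε ^ 2) := by
  obtain ⟨a, ha⟩ := hw.exists_norm_lt o hη hε
  have ho : IsOpen {ψ : lp (fun _ : V => ℂ) 2 | ‖ψ - lp.single 2 o 1‖ < ε} :=
    isOpen_lt (by fun_prop) (by fun_prop)
  obtain ⟨_, hl, l, rfl⟩ := mem_closure_iff.1 (shiftedAdjacency_mem_closure hw η a) _ ho
    ha
  refine ⟨l, ?_⟩
  rw [defect_eq hw, ENNReal.ofReal_lt_ofReal_iff (by positivity)]
  exact pow_lt_pow_left₀ hl (norm_nonneg _) two_ne_zero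

lemma norm_sub_coefAt_le (hw : IsDeterminate w) {η : ℂ} (hη : η.im ≠ 0) (o : V) {ε : ℝ}
    (hε : 0 < ε) {l : List (V × ℕ)} (hl : defect w η o l < ENNReal.ofReal (ε ^ 2)) :
    ‖rootResolvent w o η - coefAt o l‖ ≤ ε / |η.im| := by
  classical
  rw [defect_eq hw, ENNReal.ofReal_lt_ofReal_iff (by positivity)] at hl
  have h1 := lt_of_pow_lt_pow_left₀ 2 hε.le hl
  have h2 := hw.norm_rootResolvent_sub_le o hη (listVector hw l)
  rw [listVector_apply] at h2
  rw [le_div_iff₀ (abs_pos.2 hη), mul_comm]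
  exact h2.trans h1.le

variable {X : Type*} [MeasurableSpace X] {m : Measure X}

lemma measurable_defect [Countable V] {w : X → V → V → ℂ}
    (hm : ∀ u v, Measurable fun x => w x u v) (η : ℂ) (o : V) (l : List (V × ℕ)) :
    Measurable fun x => defect (w x) η o l := by
  classical
  refine Measurable.tsum fun u => ?_
  have h : Measurable fun x => defectAt (w x) η o l u := by
    unfold defectAt
    refine Measurable.sub_const ?_ _
    induction l with
    | nil => simp
    | cons p l ih =>
      simp only [List.map_cons, List.sum_cons]
      exact (((hm u p.1).sub_const _).const_mul _).add ih
  exact (h.norm.pow_const 2).ennreal_ofReal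

/-- There are countably many lists of approximate coefficients, and each defect is measurable in the
weights. Choosing measurably the first list with small defect gives entries that converge to the
resolvent entry. -/
theorem aemeasurable_rootResolvent [Countable V] {w : X → V → V → ℂ}
    (hm : ∀ u v, Measurable fun x => w x u v) (hw : ∀ᵐ x ∂m, IsDeterminate (w x)) {η : ℂ}
    (hη : η.im ≠ 0) (o : V) : AEMeasurable (fun x => rootResolvent (w x) o η) m := by
  classical
  obtain ⟨L, hL⟩ := exists_surjective_nat (List (V × ℕ))
  let ε : ℕ → ℝ := fun n => 1 / ((n : ℝ) + 1)
  have hε : ∀ n, 0 < ε n := fun n => by positivity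
  -- The second alternative makes the search total at exceptional `x`; for determinate weights it
  -- never occurs.
  let p : ℕ → X → ℕ → Prop := fun n x N =>
    defect (w x) η o (L N) < ENNReal.ofReal (ε n ^ 2) ∨
      ∀ N, ¬ defect (w x) η o (L N) < ENNReal.ofReal (ε n ^ 2)
  have hp : ∀ n x, ∃ N, p n x N := fun n x => by
    by_cases h : ∃ N, defect (w x) η o (L N) < ENNReal.ofReal (ε n ^ 2)
    · exact ⟨h.choose, Or.inl h.choose_spec⟩
    · exact ⟨0, Or.inr (not_exists.1 h)⟩
  have hmp : ∀ n N, MeasurableSet {x | p n x N} := fun n N => by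
    have h1 : ∀ N, MeasurableSet {x | defect (w x) η o (L N) < ENNReal.ofReal (ε n ^ 2)} :=
      fun N => measurableSet_lt (measurable_defect hm η o (L N)) measurable_const
    refine (h1 N).union ?_
    have h2 : {x | ∀ N, ¬ defect (w x) η o (L N) < ENNReal.ofReal (ε n ^ 2)} =
        ⋂ N, {x | defect (w x) η o (L N) < ENNReal.ofReal (ε n ^ 2)}ᶜ := by
      ext x
      simp
    exact (congrArg MeasurableSet h2).mpr (MeasurableSet.iInter fun N => (h1 N).compl)
  refine aemeasurable_of_tendsto_metrizable_ae atTop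
    (f := fun n x => coefAt o (L (Nat.find (hp n x)))) (fun n => ?_) ?_
  · exact ((measurable_from_nat (f := fun N => coefAt o (L N))).comp
      (measurable_find (hp n) (hmp n))).aemeasurable
  · filter_upwards [hw] with x hx
    have h1 : ∀ n, defect (w x) η o (L (Nat.find (hp n x))) < ENNReal.ofReal (ε n ^ 2) := by
      intro n
      rcases Nat.find_spec (hp n x) with h | h
      · exact h
      · obtain ⟨l, hl⟩ := exists_defect_lt hx hη o (hε n)
        obtain ⟨N, rfl⟩ := hL l
        exact absurd hl (h N)
    rw [tendsto_iff_norm_sub_tendsto_zero]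
    refine squeeze_zero (fun n => norm_nonneg _) (fun n => ?_)
      (g := fun n => ε n / |η.im|) ?_
    · rw [norm_sub_rev]
      exact norm_sub_coefAt_le hx hη o (hε n) (h1 n)
    · simpa only [zero_div] using
        (tendsto_one_div_add_atTop_nhds_zero_nat (𝕜 := ℝ)).div_const |η.im|

end Measurability

@[fun_prop]
lemma measurable_tsum_coord (k : Word) :
    Measurable fun x : Word → ℕ → ℝ => ∑' i, x k i :=
  Measurable.tsum fun i => by fun_prop

lemma measurable_edgeWeight (s : Bool) (z : ℂ) (k : Word) (a : Option ℕ) :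
    Measurable fun x : Word → ℕ → ℝ => edgeWeight s z x k a := by
  have hp : Measurable fun x : Word → ℕ → ℝ => parentPoint x k := by
    rcases k with _ | ⟨_ | i, v⟩ <;> simp only [parentPoint] <;> fun_prop
  cases a with
  | none => simp [edgeWeight]
  | some j =>
    simp only [edgeWeight]
    split_ifs
    · unfold zetaHat
      fun_prop
    · unfold omegaHat
      fun_prop

lemma measurable_treeWeight (s : Bool) (z : ℂ) (u v : Word) :
    Measurable fun x : Word → ℕ → ℝ => treeWeight s z x u v := by
  unfold treeWeight
  refine Measurable.add ?_ ?_
  · rcases v with _ | ⟨a, k⟩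
    · simp
    · by_cases h : k = u
      · simpa [h] using measurable_edgeWeight s z u a
      · simp [h]
  · rcases u with _ | ⟨a, k⟩
    · simp
    · by_cases h : k = v
      · simpa [h] using! Complex.continuous_conj.measurable.comp (measurable_edgeWeight s z v a)
      · simp [h]

lemma aemeasurable_hRes {α : ℝ} (hα : 0 < α ∧ α < 1) {η : ℂ} (hη : 0 < η.im) (s : Bool) (z : ℂ) :
    AEMeasurable (hRes s η z) (fieldLaw α) := by
  refine aemeasurable_rootResolvent (w := fun x => hatTree s z x)
    (fun u v => measurable_treeWeight s z u v) ?_ hη.ne' _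
  filter_upwards [ae_isRegular hα] with x hx
  exact hx.isDeterminate_hatTree s z

lemma aemeasurable_hBar {α : ℝ} (hα : 0 < α ∧ α < 1) {η : ℂ} (hη : 0 < η.im) (s : Bool) (z : ℂ) :
    AEMeasurable (hBar s η z) (fieldLaw α) := by
  refine aemeasurable_rootResolvent (w := fun x => barTree s z x)
    (fun u v => measurable_treeWeight s z u v) ?_ hη.ne' _
  filter_upwards [ae_isRegular hα] with x hx
  exact hx.isDeterminate_barTree s z

end

section

/-! ### Independence of disjoint blocks of coordinates of an infinite product measure -/

section Blocks

variable {I X : Type*} [mX : MeasurableSpace X]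

/-- The σ-algebra of the coordinates in `S`. -/
@[reducible]
def coordAlgebra (X : Type*) [mX : MeasurableSpace X] (S : Set I) : MeasurableSpace (I → X) :=
  ⨆ i ∈ S, mX.comap fun x => x i

lemma coordAlgebra_le (S : Set I) : coordAlgebra X S ≤ MeasurableSpace.pi :=
  iSup₂_le fun i _ => (measurable_pi_apply i).comap_le

lemma measurable_eval_coordAlgebra {S : Set I} {i : I} (hi : i ∈ S) :
    Measurable[coordAlgebra X S] fun x : I → X => x i :=
  measurable_iff_comap_le.2 (le_iSup₂_of_le i hi le_rfl)

lemma measurable_block_coordAlgebra {S : Set I} {B : Type*} {f : B → I} (hf : ∀ b, f b ∈ S) :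
    Measurable[coordAlgebra X S] fun (x : I → X) b => x (f b) :=
  @measurable_pi_lambda _ _ _ (coordAlgebra X S) _ _ fun b => measurable_eval_coordAlgebra (hf b)

variable {μ : Measure X} [IsProbabilityMeasure μ]

lemma indepFun_of_disjoint_coordinates {S T : Set I} (hST : Disjoint S T) {E F : Type*}
    [MeasurableSpace E] [MeasurableSpace F] {f : (I → X) → E} {g : (I → X) → F}
    (hf : Measurable[coordAlgebra X S] f) (hg : Measurable[coordAlgebra X T] g) :
    IndepFun f g (Measure.infinitePi fun _ : I => μ) := by
  rw [IndepFun_iff_Indep]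
  have h : iIndepFun (fun (i : I) (x : I → X) => x i) (Measure.infinitePi fun _ : I => μ) :=
    iIndepFun_infinitePi (X := fun _ t => t) fun _ => measurable_id
  exact indep_of_indep_of_le (indep_iSup_of_disjoint
    (fun i => (measurable_pi_apply i).comap_le) h hST) hf.comap_le hg.comap_le

lemma hasLaw_reindex {B : Type*} {f : B → I} (hf : Function.Injective f) :
    HasLaw (fun (x : I → X) b => x (f b)) (Measure.infinitePi fun _ : B => μ)
      (Measure.infinitePi fun _ : I => μ) where
  aemeasurable := Measurable.aemeasurable (by fun_prop)
  map_eq := Measure.map_infinitePi_infinitePi_of_inj hf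

/-- Injectivity of the uncurried index map makes the joint law a product over `A × B`; currying
turns it into a product over `A` of block laws. -/
lemma iIndepFun_blocks {A B : Type*} {f : A → B → I}
    (hf : Function.Injective (Function.uncurry f)) :
    iIndepFun (fun a (x : I → X) b => x (f a b)) (Measure.infinitePi fun _ : I => μ) := by
  have h1 : ∀ a, HasLaw (fun (x : I → X) b => x (f a b)) (Measure.infinitePi fun _ : B => μ)
      (Measure.infinitePi fun _ : I => μ) := fun a =>
    hasLaw_reindex fun b c h => (Prod.ext_iff.1 (@hf (a, b) (a, c) h)).2
  rw [iIndepFun_iff_hasLaw_Pi_infinitePi h1 (Measurable.aemeasurable (by fun_prop))]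
  have h2 : HasLaw (MeasurableEquiv.curry A B X)
      (Measure.infinitePi fun _ : A => Measure.infinitePi fun _ : B => μ)
      (Measure.infinitePi fun _ : A × B => μ) :=
    ⟨by fun_prop, Measure.infinitePi_map_curry (fun (_ : A) (_ : B) => μ)⟩
  exact h2.comp (hasLaw_reindex hf)

end Blocks

lemma measurableSet_setOf_summable {T ι : Type*} [Countable ι] [MeasurableSpace T] {f : ι → T → ℂ}
    (hf : ∀ i, Measurable (f i)) : MeasurableSet {t | Summable fun i => f i t} := by
  have h : {t | Summable fun i => f i t} = {t | ∑' i, ‖f i t‖ₑ < ∞} := by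
    ext t
    change (Summable fun i => f i t) ↔ ∑' i, ‖f i t‖ₑ < ∞
    refine summable_norm_iff.symm.trans (Iff.trans ?_ lt_top_iff_ne_top.symm)
    exact (NNReal.summable_coe (f := fun i => ‖f i t‖₊)).trans
      ENNReal.tsum_coe_ne_top_iff_summable.symm
  rw [h]
  exact measurableSet_lt (Measurable.tsum fun i => (hf i).enorm) measurable_const

/-! ### The laws of the points of subtrees -/

variable {α : ℝ}

lemma shift_injective_index (a : Option ℕ) : Function.Injective fun k : Word => k ++ [a] :=
  fun _ _ h => List.append_cancel_right h

lemma hasLaw_shift (α : ℝ) (a : Option ℕ) : HasLaw (shift a) (fieldLaw α) (fieldLaw α) :=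
  hasLaw_reindex (shift_injective_index a)

lemma hasLaw_eval (α : ℝ) (k : Word) :
    HasLaw (fun x : Word → ℕ → ℝ => x k) (pppLaw α) (fieldLaw α) :=
  (measurePreserving_eval_fieldLaw α k).hasLaw

lemma indepFun_fieldLaw {S T : Set Word} (hST : Disjoint S T) {E F : Type*}
    [MeasurableSpace E] [MeasurableSpace F] {f : (Word → ℕ → ℝ) → E} {g : (Word → ℕ → ℝ) → F}
    (hf : Measurable[coordAlgebra (ℕ → ℝ) S] f) (hg : Measurable[coordAlgebra (ℕ → ℝ) T] g) :
    IndepFun f g (fieldLaw α) :=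
  indepFun_of_disjoint_coordinates hST hf hg

lemma iIndepFun_shift (α : ℝ) :
    iIndepFun (fun k : ℕ => shift (some k)) (fieldLaw α) := by
  refine iIndepFun_blocks (f := fun (k : ℕ) (w : Word) => w ++ [some k]) ?_
  rintro ⟨k, v⟩ ⟨l, w⟩ h
  obtain ⟨rfl, h⟩ := List.append_inj' h rfl
  simpa using h

lemma iIndepFun_shift_shift (α : ℝ) :
    iIndepFun (fun (p : ℕ × ℕ) (x : Word → ℕ → ℝ) => shift (some p.2) (shift (some p.1) x))
      (fieldLaw α) := by
  refine iIndepFun_blocks (f := fun (p : ℕ × ℕ) (w : Word) => (w ++ [some p.2]) ++ [some p.1]) ?_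
  rintro ⟨⟨k, j⟩, v⟩ ⟨⟨l, i⟩, w⟩ h
  obtain ⟨h, h1⟩ := List.append_inj' h rfl
  obtain ⟨rfl, h2⟩ := List.append_inj' h rfl
  simp only [List.cons.injEq, Option.some.injEq, and_true] at h1 h2
  simp [h1, h2]

lemma iIndepFun_shift_none_shift (α : ℝ) :
    iIndepFun (fun (k : ℕ) (x : Word → ℕ → ℝ) => shift none (shift (some k) x)) (fieldLaw α) := by
  refine iIndepFun_blocks (f := fun (k : ℕ) (w : Word) => (w ++ [none]) ++ [some k]) ?_
  rintro ⟨k, v⟩ ⟨l, w⟩ h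
  obtain ⟨h, h1⟩ := List.append_inj' h rfl
  obtain ⟨rfl, -⟩ := List.append_inj' h rfl
  simpa using h1

lemma iIndepFun_eval_child (α : ℝ) :
    iIndepFun (fun (k : ℕ) (x : Word → ℕ → ℝ) => x [some k]) (fieldLaw α) := by
  have h : iIndepFun (fun (i : Word) (x : Word → ℕ → ℝ) => x i) (fieldLaw α) :=
    iIndepFun_infinitePi (X := fun _ t => t) fun _ => measurable_id
  exact h.precomp (g := fun k : ℕ => [some k]) fun k l h => by simpa using h

end

section

/-! ### Transfer of almost sure properties and laws -/

section Transfer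

variable {T E : Type*} {Ω : Type*} [MeasurableSpace T] [MeasurableSpace E] [MeasurableSpace Ω]
  {μ : Measure T} {P : Measure Ω} {X : Ω → T}

lemma ae_of_hasLaw (hX : HasLaw X μ P) {p : T → Prop} (h : ∀ᵐ x ∂μ, p x) :
    ∀ᵐ ω ∂P, p (X ω) :=
  ae_of_ae_map hX.aemeasurable (hX.map_eq.symm ▸ h)

lemma identDistrib_of_hasLaw (hX : HasLaw X μ P) {f : T → E} (hf : AEMeasurable f μ) :
    IdentDistrib (fun ω => f (X ω)) f P μ :=
  (⟨hf, rfl⟩ : HasLaw f (μ.map f) μ).fun_comp hX |>.identDistrib ⟨hf, rfl⟩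

end Transfer

lemma IsPoissonField.hasLaw_fieldLaw {Ω : Type*} [MeasurableSpace Ω] {P : Measure Ω} {α : ℝ}
    {ξ : Word → Ω → ℕ → ℝ} (hξ : IsPoissonField α ξ P) :
    HasLaw (fun ω k => ξ k ω) (fieldLaw α) P :=
  hξ.indep.hasLaw_infinitePi hξ.hasLaw (aemeasurable_pi_iff.2 fun k => (hξ.hasLaw k).aemeasurable)

/-! ### The right-hand sides as measurable functions of independent blocks -/

/-- The right-hand side of the equation for `hBar true`. -/
def plusMap (η : ℂ) (q : (ℕ → ℝ) × (ℕ → ℂ)) : ℂ := psi η (∑' k, (q.1 k : ℂ) ^ 2 * q.2 k)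

/-- The arguments of `plusMap`, with `K` evaluated at the points of the subtrees. -/
def plusTuple (K : (Word → ℕ → ℝ) → ℂ) (x : Word → ℕ → ℝ) : (ℕ → ℝ) × (ℕ → ℂ) :=
  (fun k => x [] k / ∑' j, x [] j, fun k => K (shift (some k) x))

/-- The points at the root, those at its children, and the values at the pending and at the
ordinary children of these. -/
abbrev MinusData : Type := (ℕ → ℝ) × (ℕ → ℕ → ℝ) × (ℕ → ℂ) × (ℕ × ℕ → ℂ)

/-- The `j`-th term of the inner sum in the equation for `hBar false`. -/
def innerTerm (q : MinusData) (k j : ℕ) : ℂ :=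
  (innerWeight q.1 q.2.1 k j : ℂ) ^ 2 * q.2.2.2 (k, j)

/-- The `k`-th term of the outer sum in the equation for `hBar false`. -/
def outerTerm (η z : ℂ) (q : MinusData) (k : ℕ) : ℂ :=
  (outerWeight q.1 q.2.1 k : ℂ) ^ 2 *
    psi η ((‖z‖ : ℂ) ^ 2 * q.2.2.1 k + ∑' j, innerTerm q k j)

/-- The right-hand side of the equation for `hBar false`. -/
def minusMap (η z : ℂ) (q : MinusData) : ℂ := psi η (∑' k, outerTerm η z q k)

/-- The arguments of `minusMap`, with `G` and `K` evaluated at the points of the subtrees. -/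
def minusTuple (G K : (Word → ℕ → ℝ) → ℂ) (x : Word → ℕ → ℝ) : MinusData :=
  (x [], fun k => x [some k], fun k => G (shift none (shift (some k) x)),
    fun p => K (shift (some p.2) (shift (some p.1) x)))

lemma measurable_psi (η : ℂ) : Measurable (psi η) := by
  unfold psi
  fun_prop

lemma measurable_plusTerm (k : ℕ) :
    Measurable fun q : (ℕ → ℝ) × (ℕ → ℂ) => (q.1 k : ℂ) ^ 2 * q.2 k := by
  fun_prop

lemma measurable_plusMap (η : ℂ) : Measurable (plusMap η) :=
  (measurable_psi η).comp (Measurable.tsum measurable_plusTerm)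

lemma measurable_childPoints_tsum (k : ℕ) :
    Measurable fun q : MinusData => ∑' i, q.2.1 k i :=
  Measurable.tsum fun i => by fun_prop

lemma measurable_innerTerm (k j : ℕ) : Measurable fun q => innerTerm q k j := by
  have := measurable_childPoints_tsum k
  unfold innerTerm innerWeight
  fun_prop

lemma measurable_outerTerm (η z : ℂ) (k : ℕ) : Measurable fun q => outerTerm η z q k := by
  have h1 := measurable_childPoints_tsum k
  have h2 : Measurable fun q : MinusData => ∑' j, innerTerm q k j :=
    Measurable.tsum (measurable_innerTerm k)
  have h3 := measurable_psi η
  unfold outerTerm outerWeight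
  fun_prop

lemma measurable_minusMap (η z : ℂ) : Measurable (minusMap η z) :=
  (measurable_psi η).comp (Measurable.tsum (measurable_outerTerm η z))

/-! ### Measurability and independence of the blocks -/

lemma measurable_shift_coordAlgebra {S : Set Word} {a : Option ℕ} (h : ∀ w : Word, w ++ [a] ∈ S) :
    Measurable[coordAlgebra (ℕ → ℝ) S] (shift a) :=
  measurable_block_coordAlgebra h

lemma measurable_shift_shift_coordAlgebra {S : Set Word} {a b : Option ℕ}
    (h : ∀ w : Word, (w ++ [a]) ++ [b] ∈ S) :
    Measurable[coordAlgebra (ℕ → ℝ) S] fun x => shift a (shift b x) :=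
  measurable_block_coordAlgebra h

lemma measurable_prodMk_coordAlgebra {S : Set Word} {E F : Type*} [MeasurableSpace E]
    [MeasurableSpace F] {f : (Word → ℕ → ℝ) → E} {g : (Word → ℕ → ℝ) → F}
    (hf : Measurable[coordAlgebra (ℕ → ℝ) S] f) (hg : Measurable[coordAlgebra (ℕ → ℝ) S] g) :
    Measurable[coordAlgebra (ℕ → ℝ) S] fun x => (f x, g x) :=
  Measurable.prodMk hf hg

lemma measurable_pi_coordAlgebra {S : Set Word} {ι E : Type*} [MeasurableSpace E]
    {f : ι → (Word → ℕ → ℝ) → E} (hf : ∀ i, Measurable[coordAlgebra (ℕ → ℝ) S] (f i)) :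
    Measurable[coordAlgebra (ℕ → ℝ) S] fun x i => f i x :=
  @measurable_pi_lambda _ _ _ (coordAlgebra (ℕ → ℝ) S) _ _ hf

/-- The words outside of the subtree at the additional child of the root. -/
def outerWords : Set Word := {k | k.getLast? ≠ some none}

section Measurability

variable {G K : (Word → ℕ → ℝ) → ℂ} {S : Set Word}

lemma measurable_normalize_coordAlgebra (h : [] ∈ S) :
    Measurable[coordAlgebra (ℕ → ℝ) S] fun x => (plusTuple K x).1 :=
  measurable_normalize.comp (measurable_eval_coordAlgebra h)

lemma measurable_plusTuple_snd (hK : Measurable K) (h : ∀ w k, w ++ [some k] ∈ S) :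
    Measurable[coordAlgebra (ℕ → ℝ) S] fun x => (plusTuple K x).2 :=
  measurable_pi_coordAlgebra fun k => hK.comp (measurable_shift_coordAlgebra fun w => h w k)

lemma measurable_children_coordAlgebra (h : ∀ k, [some k] ∈ S) :
    Measurable[coordAlgebra (ℕ → ℝ) S] fun x => (minusTuple G K x).2.1 :=
  measurable_block_coordAlgebra h

lemma measurable_pending_coordAlgebra (hG : Measurable G)
    (h : ∀ w k, (w ++ [none]) ++ [some k] ∈ S) :
    Measurable[coordAlgebra (ℕ → ℝ) S] fun x => (minusTuple G K x).2.2.1 :=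
  measurable_pi_coordAlgebra fun k =>
    hG.comp (measurable_shift_shift_coordAlgebra fun w => h w k)

lemma measurable_grandchildren_coordAlgebra (hK : Measurable K)
    (h : ∀ w k j, (w ++ [some j]) ++ [some k] ∈ S) :
    Measurable[coordAlgebra (ℕ → ℝ) S] fun x => (minusTuple G K x).2.2.2 :=
  measurable_pi_coordAlgebra fun p =>
    hK.comp (measurable_shift_shift_coordAlgebra fun w => h w p.1 p.2)

lemma measurable_plusTuple (hK : Measurable K) :
    Measurable[coordAlgebra (ℕ → ℝ) outerWords] (plusTuple K) :=
  measurable_prodMk_coordAlgebra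
    (measurable_normalize_coordAlgebra (K := K) (by simp [outerWords]))
    (measurable_plusTuple_snd hK fun w k => by simp [outerWords])

lemma measurable_minusTuple (hG : Measurable G) (hK : Measurable K) :
    Measurable[coordAlgebra (ℕ → ℝ) outerWords] (minusTuple G K) :=
  measurable_prodMk_coordAlgebra (measurable_eval_coordAlgebra (by simp [outerWords]))
    (measurable_prodMk_coordAlgebra
      (measurable_children_coordAlgebra (G := G) (K := K) fun k => by simp [outerWords])
      (measurable_prodMk_coordAlgebra
        (measurable_pending_coordAlgebra (K := K) hG fun w k => by simp [outerWords])
        (measurable_grandchildren_coordAlgebra (G := G) hK fun w k j => by simp [outerWords])))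

variable {α : ℝ}

lemma indepFun_outerWords_shift_none {E F : Type*} [MeasurableSpace E] [MeasurableSpace F]
    {f : (Word → ℕ → ℝ) → E} (hf : Measurable[coordAlgebra (ℕ → ℝ) outerWords] f)
    {g : (Word → ℕ → ℝ) → F} (hg : Measurable g) :
    IndepFun f (fun x => g (shift none x)) (fieldLaw α) :=
  indepFun_fieldLaw disjoint_compl_right hf
    (hg.comp (measurable_shift_coordAlgebra fun w => by simp [outerWords]))

lemma indepFun_plusTuple (hK : Measurable K) :
    IndepFun (fun x => (plusTuple K x).1) (fun x => (plusTuple K x).2) (fieldLaw α) :=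
  indepFun_fieldLaw (S := {[]}) (T := {[]}ᶜ) disjoint_compl_right
    (measurable_normalize_coordAlgebra rfl) (measurable_plusTuple_snd hK fun w k => by simp)

lemma indepFun_minusTuple_fst (hG : Measurable G) (hK : Measurable K) :
    IndepFun (fun x => (minusTuple G K x).1) (fun x => (minusTuple G K x).2) (fieldLaw α) :=
  indepFun_fieldLaw (S := {[]}) (T := {[]}ᶜ) disjoint_compl_right
    (measurable_eval_coordAlgebra rfl)
    (measurable_prodMk_coordAlgebra
      (measurable_children_coordAlgebra (G := G) (K := K) fun k => by simp)
      (measurable_prodMk_coordAlgebra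
        (measurable_pending_coordAlgebra (K := K) hG fun w k => by simp)
        (measurable_grandchildren_coordAlgebra (G := G) hK fun w k j => by simp)))

/-- The points at the children are indexed by words of length one, the remaining data by words of
length at least two. -/
lemma indepFun_minusTuple_snd (hG : Measurable G) (hK : Measurable K) :
    IndepFun (fun x => (minusTuple G K x).2.1) (fun x => (minusTuple G K x).2.2)
      (fieldLaw α) := by
  refine indepFun_fieldLaw (S := {w | w.length = 1}) (T := {w | w.length = 1}ᶜ)
    disjoint_compl_right
    (measurable_children_coordAlgebra (G := G) (K := K) fun k => by simp)
    (measurable_prodMk_coordAlgebra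
      (measurable_pending_coordAlgebra (K := K) hG fun w k => by simp)
      (measurable_grandchildren_coordAlgebra (G := G) hK fun w k j => by simp))

/-- The second label on the path from the root separates the blocks: it is `none` below pending
nodes and `some j` below ordinary grandchildren. -/
lemma indepFun_minusTuple_values (hG : Measurable G) (hK : Measurable K) :
    IndepFun (fun x => (minusTuple G K x).2.2.1) (fun x => (minusTuple G K x).2.2.2)
      (fieldLaw α) := by
  refine indepFun_fieldLaw (S := {w | ∃ v k, w = (v ++ [none]) ++ [k]})
    (T := {w | ∃ v k, w = (v ++ [none]) ++ [k]}ᶜ) disjoint_compl_right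
    (measurable_pending_coordAlgebra (K := K) hG fun w k => ⟨w, some k, rfl⟩)
    (measurable_grandchildren_coordAlgebra (G := G) hK fun w k j => ?_)
  rintro ⟨v, l, h⟩
  obtain ⟨h, -⟩ := List.append_inj' h rfl
  obtain ⟨-, h⟩ := List.append_inj' h rfl
  simp at h

end Measurability

end

section

/-! ### Distributional identities on the canonical space -/

variable {α : ℝ} {G K : (Word → ℕ → ℝ) → ℂ} {Ω : Type*} [MeasurableSpace Ω] {P : Measure Ω}

lemma ae_plusTuple_congr {K' : (Word → ℕ → ℝ) → ℂ} (hK : K =ᵐ[fieldLaw α] K') :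
    plusTuple K =ᵐ[fieldLaw α] plusTuple K' := by
  have h : ∀ᵐ x ∂fieldLaw α, ∀ k : ℕ, K (shift (some k) x) = K' (shift (some k) x) :=
    ae_all_iff.2 fun k => ae_of_hasLaw (hasLaw_shift α (some k)) hK
  filter_upwards [h] with x hx
  exact Prod.ext rfl (funext hx)

lemma ae_minusTuple_congr {G' K' : (Word → ℕ → ℝ) → ℂ} (hG : G =ᵐ[fieldLaw α] G')
    (hK : K =ᵐ[fieldLaw α] K') : minusTuple G K =ᵐ[fieldLaw α] minusTuple G' K' := by
  have h1 : ∀ᵐ x ∂fieldLaw α, ∀ k : ℕ,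
      G (shift none (shift (some k) x)) = G' (shift none (shift (some k) x)) :=
    ae_all_iff.2 fun k =>
      ae_of_hasLaw ((hasLaw_shift α none).fun_comp (hasLaw_shift α (some k))) hG
  have h2 : ∀ᵐ x ∂fieldLaw α, ∀ p : ℕ × ℕ,
      K (shift (some p.2) (shift (some p.1) x)) = K' (shift (some p.2) (shift (some p.1) x)) :=
    ae_all_iff.2 fun p =>
      ae_of_hasLaw ((hasLaw_shift α (some p.2)).fun_comp (hasLaw_shift α (some p.1))) hK
  filter_upwards [h1, h2] with x hx hx'
  exact Prod.ext rfl (Prod.ext rfl (Prod.ext (funext hx) (funext hx')))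

lemma identDistrib_plusTuple (hK : AEMeasurable K (fieldLaw α)) {ζ : Ω → ℕ → ℝ} {H : ℕ → Ω → ℂ}
    (hζ : HasLaw ζ (pdLaw α) P) (hH : IsIIDCopies H P K (fieldLaw α))
    (hζH : IndepFun ζ (fun ω k => H k ω) P) :
    IdentDistrib (plusTuple K) (fun ω => (ζ ω, fun k => H k ω)) (fieldLaw α) P := by
  have hm := hK.measurable_mk
  -- Independence of blocks needs functions measurable in the coordinates of the block, so `K` is
  -- replaced by its measurable modification.
  refine (IdentDistrib.of_ae_eq (((measurable_plusTuple hm).mono (coordAlgebra_le _)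
    le_rfl).aemeasurable) (ae_plusTuple_congr hK.ae_eq_mk.symm)).symm.trans ?_
  refine IdentDistrib.prodMk (X := fun x => (plusTuple (hK.mk K) x).1)
    (Y := fun x => (plusTuple (hK.mk K) x).2) ?_ ?_ (indepFun_plusTuple hm) hζH
  · exact ((⟨measurable_normalize.aemeasurable, rfl⟩ :
      HasLaw _ (pdLaw α) (pppLaw α)).fun_comp (hasLaw_eval α [])).identDistrib hζ
  · refine IdentDistrib.pi (X := fun k x => hK.mk K (shift (some k) x)) (fun k => ?_)
      ((iIndepFun_shift α).comp (fun _ => hK.mk K) fun _ => hm) hH.indep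
    exact (identDistrib_of_hasLaw (hasLaw_shift α _) hm.aemeasurable).trans
      (hK.identDistrib_mk.symm.trans (hH.identDistrib k).symm)

lemma identDistrib_minusTuple (hG : AEMeasurable G (fieldLaw α)) (hK : AEMeasurable K (fieldLaw α))
    {x : Ω → ℕ → ℝ} {y : ℕ → Ω → ℕ → ℝ} {b : ℕ → Ω → ℂ} {H : ℕ × ℕ → Ω → ℂ}
    (hx : HasLaw x (pppLaw α) P) (hy : iIndepFun y P) (hy' : ∀ k, HasLaw (y k) (pppLaw α) P)
    (hb : IsIIDCopies b P G (fieldLaw α)) (hH : IsIIDCopies H P K (fieldLaw α))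
    (h1 : IndepFun x (fun ω => ((fun k => y k ω), (fun k => b k ω), (fun p => H p ω))) P)
    (h2 : IndepFun (fun ω k => y k ω) (fun ω => ((fun k => b k ω), (fun p => H p ω))) P)
    (h3 : IndepFun (fun ω k => b k ω) (fun ω p => H p ω) P) :
    IdentDistrib (minusTuple G K)
      (fun ω => (x ω, (fun k => y k ω), (fun k => b k ω), (fun p => H p ω))) (fieldLaw α) P := by
  have hmG := hG.measurable_mk
  have hmK := hK.measurable_mk
  refine (IdentDistrib.of_ae_eq (((measurable_minusTuple hmG hmK).mono (coordAlgebra_le _)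
    le_rfl).aemeasurable) (ae_minusTuple_congr hG.ae_eq_mk.symm hK.ae_eq_mk.symm)).symm.trans ?_
  set G' := hG.mk G
  set K' := hK.mk K
  refine IdentDistrib.prodMk (X := fun x => (minusTuple G' K' x).1)
    (Y := fun x => (minusTuple G' K' x).2) ((hasLaw_eval α []).identDistrib hx) ?_
    (indepFun_minusTuple_fst hmG hmK) h1
  refine IdentDistrib.prodMk (X := fun x => (minusTuple G' K' x).2.1)
    (Y := fun x => (minusTuple G' K' x).2.2) ?_ ?_ (indepFun_minusTuple_snd hmG hmK) h2
  · exact IdentDistrib.pi (X := fun (k : ℕ) (x : Word → ℕ → ℝ) => x [some k])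
      (fun k => (hasLaw_eval α [some k]).identDistrib (hy' k)) (iIndepFun_eval_child α) hy
  refine IdentDistrib.prodMk (X := fun x => (minusTuple G' K' x).2.2.1)
    (Y := fun x => (minusTuple G' K' x).2.2.2) ?_ ?_ (indepFun_minusTuple_values hmG hmK) h3
  · refine IdentDistrib.pi (X := fun k x => G' (shift none (shift (some k) x))) (fun k => ?_)
      ((iIndepFun_shift_none_shift α).comp (fun _ => G') fun _ => hmG) hb.indep
    exact (identDistrib_of_hasLaw ((hasLaw_shift α _).fun_comp (hasLaw_shift α _))
      hmG.aemeasurable).trans (hG.identDistrib_mk.symm.trans (hb.identDistrib k).symm)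
  · refine IdentDistrib.pi (X := fun p x => K' (shift (some p.2) (shift (some p.1) x)))
      (fun p => ?_) ((iIndepFun_shift_shift α).comp (fun _ => K') fun _ => hmK) hH.indep
    exact (identDistrib_of_hasLaw ((hasLaw_shift α _).fun_comp (hasLaw_shift α _))
      hmK.aemeasurable).trans (hK.identDistrib_mk.symm.trans (hH.identDistrib p).symm)

/-! ### Identities in distribution for the resolvent entries -/

variable {η z : ℂ}

lemma IsRegular.summable_plusTuple {x : Word → ℕ → ℝ} (hx : IsRegular x) (hη : 0 < η.im) :
    Summable fun k => ((plusTuple (hRes false η z) x).1 k : ℂ) ^ 2 *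
      (plusTuple (hRes false η z) x).2 k := by
  simpa only [plusTuple, zero_add] using hx.summable_childSum_true hη (z := z) le_rfl

lemma IsRegular.hBar_true_eq {x : Word → ℕ → ℝ} (hx : IsRegular x) (hη : 0 < η.im) :
    hBar true η z x = plusMap η (plusTuple (hRes false η z) x) := by
  rw [hx.hBar_eq_psi hη, hx.childSum_true hη]
  simp only [plusMap, plusTuple, zero_add]

lemma IsRegular.hBar_false_eq {x : Word → ℕ → ℝ} (hx : IsRegular x) (hη : 0 < η.im) :
    hBar false η z x = minusMap η z (minusTuple (hBar false η z) (hRes false η z) x) := by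
  rw [hx.hBar_eq_psi hη, hx.childSum_false hη]
  rfl

/-- The value at the pending vertices is irrelevant if the parameter vanishes. -/
lemma outerTerm_zero_congr {x : ℕ → ℝ} {y : ℕ → ℕ → ℝ} {b b' : ℕ → ℂ} {H : ℕ × ℕ → ℂ} (k : ℕ) :
    outerTerm η 0 (x, y, b, H) k = outerTerm η 0 (x, y, b', H) k := by
  simp [outerTerm, innerTerm]

/-- Removing the edge to the additional child leaves only points outside its subtree. The recursion
supplies an almost surely equal version that is measurable in those coordinates. -/
lemma indepFun_hBar_shift_none (hα : 0 < α ∧ α < 1) (hη : 0 < η.im)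
    (s t : Bool) :
    IndepFun (hBar s η z) (fun x => hBar t η z (shift none x)) (fieldLaw α) := by
  have hK := aemeasurable_hRes hα hη false z
  have hG := aemeasurable_hBar hα hη false z
  have hB := aemeasurable_hBar hα hη t z
  have h2 : (fun x => hB.mk _ (shift none x)) =ᵐ[fieldLaw α] fun x => hBar t η z (shift none x) :=
    ae_of_hasLaw (hasLaw_shift α none) hB.ae_eq_mk.symm
  cases s with
  | true =>
    refine (indepFun_outerWords_shift_none (α := α) ((measurable_plusMap η).comp
      (measurable_plusTuple hK.measurable_mk)) hB.measurable_mk).congr ?_ h2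
    filter_upwards [ae_plusTuple_congr hK.ae_eq_mk, ae_isRegular hα] with x h hx
    rw [hx.hBar_true_eq hη, h]
    rfl
  | false =>
    refine (indepFun_outerWords_shift_none (α := α) ((measurable_minusMap η z).comp
      (measurable_minusTuple hG.measurable_mk hK.measurable_mk)) hB.measurable_mk).congr ?_ h2
    filter_upwards [ae_minusTuple_congr hG.ae_eq_mk hK.ae_eq_mk, ae_isRegular hα] with x h hx
    rw [hx.hBar_false_eq hη, h]
    rfl

lemma hRes_identDistrib_div (hα : 0 < α ∧ α < 1) (hη : 0 < η.im)
    (s : Bool) {b c : Ω → ℂ}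
    (hb : IdentDistrib b (hBar s η z) P (fieldLaw α))
    (hc : IdentDistrib c (hBar (!s) η z) P (fieldLaw α)) (hbc : IndepFun b c P) :
    (∀ᵐ ω ∂P, 1 - (‖z‖ : ℂ) ^ 2 * b ω * c ω ≠ 0) ∧
    IdentDistrib (hRes s η z) (fun ω => b ω / (1 - (‖z‖ : ℂ) ^ 2 * b ω * c ω)) (fieldLaw α) P := by
  have h1 := aemeasurable_hBar hα hη (!s) z
  have h2 : IdentDistrib (fun x => hBar (!s) η z (shift none x)) c (fieldLaw α) P :=
    (identDistrib_of_hasLaw (hasLaw_shift α none) h1).trans hc.symm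
  have h3 := IdentDistrib.prodMk hb.symm h2 (indepFun_hBar_shift_none hα hη s (!s)) hbc
  have hm : Measurable fun q : ℂ × ℂ => 1 - (‖z‖ : ℂ) ^ 2 * q.1 * q.2 := by fun_prop
  constructor
  · refine h3.ae_snd (p := fun q : ℂ × ℂ => 1 - (‖z‖ : ℂ) ^ 2 * q.1 * q.2 ≠ 0)
      (hm (measurableSet_singleton 0).compl) ?_
    filter_upwards [ae_isRegular hα] with x hx
    exact one_sub_mul_ne_zero (hx.hBar_im_pos hη s) ((isRegular_shift hx none).hBar_im_pos hη _)
      (by rw [← Complex.ofReal_pow, Complex.ofReal_re]; positivity)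
      (by rw [← Complex.ofReal_pow, Complex.ofReal_im])
  · refine (IdentDistrib.of_ae_eq (aemeasurable_hRes hα hη s z) ?_).trans
      (h3.comp (u := fun q : ℂ × ℂ => q.1 / (1 - (‖z‖ : ℂ) ^ 2 * q.1 * q.2))
        (measurable_fst.div hm))
    filter_upwards [ae_isRegular hα] with x hx
    exact hx.hRes_eq_div hη s

lemma hBar_true_identDistrib (hα : 0 < α ∧ α < 1) (hη : 0 < η.im)
    {ζ : Ω → ℕ → ℝ} {H : ℕ → Ω → ℂ} (hζ : HasLaw ζ (pdLaw α) P)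
    (hH : IsIIDCopies H P (hRes false η z) (fieldLaw α))
    (hζH : IndepFun ζ (fun ω k => H k ω) P) :
    (∀ᵐ ω ∂P, Summable fun k => (ζ ω k : ℂ) ^ 2 * H k ω) ∧
    IdentDistrib (hBar true η z) (fun ω => psi η (∑' k, (ζ ω k : ℂ) ^ 2 * H k ω))
      (fieldLaw α) P := by
  have h1 := identDistrib_plusTuple (aemeasurable_hRes hα hη false z) hζ hH hζH
  constructor
  · refine h1.ae_snd (measurableSet_setOf_summable measurable_plusTerm) ?_
    filter_upwards [ae_isRegular hα] with x hx using hx.summable_plusTuple hη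
  · refine (IdentDistrib.of_ae_eq (aemeasurable_hBar hα hη true z) ?_).trans
      (h1.comp (measurable_plusMap η))
    filter_upwards [ae_isRegular hα] with x hx using hx.hBar_true_eq hη

/-- The equation for `hBar false` where the values at the pending vertices may be replaced by those
of any function `G` that gives the same terms. -/
lemma hBar_false_identDistrib (hα : 0 < α ∧ α < 1) (hη : 0 < η.im)
    (hG : AEMeasurable G (fieldLaw α))
    (hG' : ∀ x k, outerTerm η z (minusTuple G (hRes false η z) x) k =
      outerTerm η z (minusTuple (hBar false η z) (hRes false η z) x) k)
    {x : Ω → ℕ → ℝ} {y : ℕ → Ω → ℕ → ℝ} {b : ℕ → Ω → ℂ} {H : ℕ × ℕ → Ω → ℂ}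
    (hx : HasLaw x (pppLaw α) P) (hy : iIndepFun y P) (hy' : ∀ k, HasLaw (y k) (pppLaw α) P)
    (hb : IsIIDCopies b P G (fieldLaw α)) (hH : IsIIDCopies H P (hRes false η z) (fieldLaw α))
    (h1 : IndepFun x (fun ω => ((fun k => y k ω), (fun k => b k ω), (fun p => H p ω))) P)
    (h2 : IndepFun (fun ω k => y k ω) (fun ω => ((fun k => b k ω), (fun p => H p ω))) P)
    (h3 : IndepFun (fun ω k => b k ω) (fun ω p => H p ω) P) :
    (∀ᵐ ω ∂P,
      (∀ k, Summable fun j => (innerWeight (x ω) (fun k => y k ω) k j : ℂ) ^ 2 * H (k, j) ω) ∧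
      Summable fun k => (outerWeight (x ω) (fun k => y k ω) k : ℂ) ^ 2 *
        psi η ((‖z‖ : ℂ) ^ 2 * b k ω +
          ∑' j, (innerWeight (x ω) (fun k => y k ω) k j : ℂ) ^ 2 * H (k, j) ω)) ∧
    IdentDistrib (hBar false η z)
      (fun ω => psi η (∑' k, (outerWeight (x ω) (fun k => y k ω) k : ℂ) ^ 2 *
        psi η ((‖z‖ : ℂ) ^ 2 * b k ω +
          ∑' j, (innerWeight (x ω) (fun k => y k ω) k j : ℂ) ^ 2 * H (k, j) ω)))
      (fieldLaw α) P := by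
  have h := identDistrib_minusTuple hG (aemeasurable_hRes hα hη false z) hx hy hy' hb hH h1 h2 h3
  refine ⟨Filter.Eventually.and (ae_all_iff.2 fun k => ?_) ?_, ?_⟩
  · refine h.ae_snd (measurableSet_setOf_summable (measurable_innerTerm k)) ?_
    filter_upwards [ae_isRegular hα] with x hx using hx.summable_innerWeight hη k
  · refine h.ae_snd (measurableSet_setOf_summable (measurable_outerTerm η z)) ?_
    filter_upwards [ae_isRegular hα] with x hx
    exact (hx.summable_childSum_false hη).congr fun k => (hG' x k).symm
  · refine (IdentDistrib.of_ae_eq (aemeasurable_hBar hα hη false z) ?_).trans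
      (h.comp (measurable_minusMap η z))
    filter_upwards [ae_isRegular hα] with x hx
    rw [hx.hBar_false_eq hη]
    exact congrArg (psi η) (tsum_congr fun k => (hG' x k).symm)

lemma IsRegular.hBar_zero_eq {x : Word → ℕ → ℝ} (hx : IsRegular x) (hη : 0 < η.im) (s : Bool) :
    hBar s η 0 x = hRes s η 0 x := by
  rw [hx.hBar_eq_psi hη, hx.hRes_eq_psi hη]
  simp

/-- With `z = 0` the values at the pending nodes have coefficient zero. They are replaced by the
constant `0`, which is independent of everything, so no copies of `hBar false` are required. -/
lemma hRes_false_zero_identDistrib (hα : 0 < α ∧ α < 1) (hη : 0 < η.im)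
   
    {x : Ω → ℕ → ℝ} {y : ℕ → Ω → ℕ → ℝ} {H : ℕ × ℕ → Ω → ℂ}
    (hx : HasLaw x (pppLaw α) P) (hy : iIndepFun y P) (hy' : ∀ k, HasLaw (y k) (pppLaw α) P)
    (hH : IsIIDCopies H P (hRes false η 0) (fieldLaw α))
    (h1 : IndepFun x (fun ω => ((fun k => y k ω), (fun p => H p ω))) P)
    (h2 : IndepFun (fun ω k => y k ω) (fun ω p => H p ω) P) :
    (∀ᵐ ω ∂P,
      (∀ k, Summable fun j => (innerWeight (x ω) (fun k => y k ω) k j : ℂ) ^ 2 * H (k, j) ω) ∧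
      Summable fun k => (outerWeight (x ω) (fun k => y k ω) k : ℂ) ^ 2 *
        psi η (∑' j, (innerWeight (x ω) (fun k => y k ω) k j : ℂ) ^ 2 * H (k, j) ω)) ∧
    IdentDistrib (hRes false η 0)
      (fun ω => psi η (∑' k, (outerWeight (x ω) (fun k => y k ω) k : ℂ) ^ 2 *
        psi η (∑' j, (innerWeight (x ω) (fun k => y k ω) k j : ℂ) ^ 2 * H (k, j) ω)))
      (fieldLaw α) P := by
  have := hx.isProbabilityMeasure
  have h := hBar_false_identDistrib (z := 0) (G := fun _ => 0) (b := fun _ _ => (0 : ℂ)) hα hη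
    aemeasurable_const (fun _ k => outerTerm_zero_congr k) hx hy hy'
    ⟨hy.comp (fun _ _ => (0 : ℂ)) fun _ => measurable_const,
      fun _ => ⟨aemeasurable_const, aemeasurable_const, by simp⟩⟩ hH
    (h1.comp (φ := id) (ψ := fun q : (ℕ → ℕ → ℝ) × (ℕ × ℕ → ℂ) =>
      (q.1, (fun _ => 0 : ℕ → ℂ), q.2)) measurable_id
      (measurable_fst.prodMk (measurable_const.prodMk measurable_snd)))
    (h2.comp (φ := id) (ψ := fun q : ℕ × ℕ → ℂ => ((fun _ => 0 : ℕ → ℂ), q)) measurable_id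
      (measurable_const.prodMk measurable_id))
    (h2.comp (φ := fun _ => (fun _ => 0 : ℕ → ℂ)) (ψ := id) measurable_const measurable_id)
  simp only [norm_zero, Complex.ofReal_zero, ne_eq, OfNat.ofNat_ne_zero, not_false_eq_true,
    zero_pow, zero_mul, zero_add] at h
  refine ⟨h.1, (IdentDistrib.of_ae_eq (aemeasurable_hRes hα hη false 0) ?_).trans h.2⟩
  filter_upwards [ae_isRegular hα] with x hx using (hx.hBar_zero_eq hη false).symm

end

end AltTree

end

theorem proposition3p4 {Ω Ω' : Type*} [MeasurableSpace Ω] [MeasurableSpace Ω']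
    (P : Measure Ω) [IsProbabilityMeasure P] (P' : Measure Ω') [IsProbabilityMeasure P']
    (α : ℝ) (hα : 0 < α ∧ α < 1) (η z : ℂ) (hη : 0 < η.im)
    (ξ : AltTree.Word → Ω → ℕ → ℝ) (hξ : AltTree.IsPoissonField α ξ P)
    -- the resolvent entries at the root, as random variables
    (h hbar : Bool → Ω → ℂ)
    (h_def : h = fun s ω => AltTree.hRes s η z (fun k => ξ k ω))
    (hbar_def : hbar = fun s ω => AltTree.hBar s η z (fun k => ξ k ω)) :
    -- the operators are almost surely self-adjoint and `S` is almost surely finite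
    (∀ s : Bool, ∀ᵐ ω ∂P,
      AltTree.IsSelfAdjointAdjacency (AltTree.hatTree s z (fun k => ξ k ω)) ∧
      AltTree.IsSelfAdjointAdjacency (AltTree.barTree s z (fun k => ξ k ω))) ∧
    (∀ᵐ x ∂(AltTree.pppLaw α), Summable x) ∧
    -- `h` in terms of independent copies `bm`, `bp` of `hbar false`, `hbar true`
    (∀ bm bp : Ω' → ℂ,
      IdentDistrib bm (hbar false) P' P → IdentDistrib bp (hbar true) P' P →
      IndepFun bm bp P' →
      (∀ᵐ ω ∂P', 1 - (‖z‖ : ℂ) ^ 2 * bm ω * bp ω ≠ 0) ∧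
      IdentDistrib (h false) (fun ω => bm ω / (1 - (‖z‖ : ℂ) ^ 2 * bm ω * bp ω)) P P' ∧
      IdentDistrib (h true) (fun ω => bp ω / (1 - (‖z‖ : ℂ) ^ 2 * bm ω * bp ω)) P P') ∧
    -- `hbar true` in terms of PD(α) weights `ζ` and i.i.d. copies `H k` of `h false`
    (∀ (ζ : Ω' → ℕ → ℝ) (H : ℕ → Ω' → ℂ),
      HasLaw ζ (AltTree.pdLaw α) P' → AltTree.IsIIDCopies H P' (h false) P →
      IndepFun ζ (fun ω k => H k ω) P' →
      (∀ᵐ ω ∂P', Summable fun k => (ζ ω k : ℂ) ^ 2 * H k ω) ∧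
      IdentDistrib (hbar true)
        (fun ω => AltTree.psi η (∑' k, (ζ ω k : ℂ) ^ 2 * H k ω)) P P') ∧
    -- first equation of the system for `(h false, hbar false)`
    (∀ (x : Ω' → ℕ → ℝ) (y : ℕ → Ω' → ℕ → ℝ) (b : ℕ → Ω' → ℂ) (H : ℕ × ℕ → Ω' → ℂ),
      HasLaw x (AltTree.pppLaw α) P' →
      iIndepFun y P' → (∀ k, HasLaw (y k) (AltTree.pppLaw α) P') →
      AltTree.IsIIDCopies b P' (hbar false) P →
      AltTree.IsIIDCopies H P' (h false) P →
      -- the four families are mutually independent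
      IndepFun x (fun ω => ((fun k => y k ω), (fun k => b k ω), (fun p => H p ω))) P' →
      IndepFun (fun ω k => y k ω) (fun ω => ((fun k => b k ω), (fun p => H p ω))) P' →
      IndepFun (fun ω k => b k ω) (fun ω p => H p ω) P' →
      (∀ᵐ ω ∂P',
        (∀ k, Summable fun j =>
          (AltTree.innerWeight (x ω) (fun k => y k ω) k j : ℂ) ^ 2 * H (k, j) ω) ∧
        Summable fun k => (AltTree.outerWeight (x ω) (fun k => y k ω) k : ℂ) ^ 2 *
          AltTree.psi η ((‖z‖ : ℂ) ^ 2 * b k ω +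
            ∑' j, (AltTree.innerWeight (x ω) (fun k => y k ω) k j : ℂ) ^ 2 * H (k, j) ω)) ∧
      IdentDistrib (hbar false)
        (fun ω => AltTree.psi η
          (∑' k, (AltTree.outerWeight (x ω) (fun k => y k ω) k : ℂ) ^ 2 *
            AltTree.psi η ((‖z‖ : ℂ) ^ 2 * b k ω +
              ∑' j, (AltTree.innerWeight (x ω) (fun k => y k ω) k j : ℂ) ^ 2 * H (k, j) ω)))
        P P') ∧
    -- second equation of the system for `(h false, hbar false)`
    (∀ (b : Ω' → ℂ) (ζ : Ω' → ℕ → ℝ) (H : ℕ → Ω' → ℂ),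
      IdentDistrib b (hbar false) P' P →
      HasLaw ζ (AltTree.pdLaw α) P' → AltTree.IsIIDCopies H P' (h false) P →
      IndepFun b (fun ω => (ζ ω, (fun k => H k ω))) P' →
      IndepFun ζ (fun ω k => H k ω) P' →
      (∀ᵐ ω ∂P', (Summable fun k => (ζ ω k : ℂ) ^ 2 * H k ω) ∧
        1 - (‖z‖ : ℂ) ^ 2 * b ω * AltTree.psi η (∑' k, (ζ ω k : ℂ) ^ 2 * H k ω) ≠ 0) ∧
      IdentDistrib (h false)
        (fun ω => b ω /
          (1 - (‖z‖ : ℂ) ^ 2 * b ω * AltTree.psi η (∑' k, (ζ ω k : ℂ) ^ 2 * H k ω))) P P') ∧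
    -- the case `z = 0`
    (z = 0 →
      (∀ s : Bool, hbar s =ᵐ[P] h s) ∧
      (∀ (x : Ω' → ℕ → ℝ) (y : ℕ → Ω' → ℕ → ℝ) (H : ℕ × ℕ → Ω' → ℂ),
        HasLaw x (AltTree.pppLaw α) P' →
        iIndepFun y P' → (∀ k, HasLaw (y k) (AltTree.pppLaw α) P') →
        AltTree.IsIIDCopies H P' (h false) P →
        IndepFun x (fun ω => ((fun k => y k ω), (fun p => H p ω))) P' →
        IndepFun (fun ω k => y k ω) (fun ω p => H p ω) P' →
        (∀ᵐ ω ∂P',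
          (∀ k, Summable fun j =>
            (AltTree.innerWeight (x ω) (fun k => y k ω) k j : ℂ) ^ 2 * H (k, j) ω) ∧
          Summable fun k => (AltTree.outerWeight (x ω) (fun k => y k ω) k : ℂ) ^ 2 *
            AltTree.psi η
              (∑' j, (AltTree.innerWeight (x ω) (fun k => y k ω) k j : ℂ) ^ 2 * H (k, j) ω)) ∧
        IdentDistrib (h false)
          (fun ω => AltTree.psi η
            (∑' k, (AltTree.outerWeight (x ω) (fun k => y k ω) k : ℂ) ^ 2 *
              AltTree.psi η
                (∑' j, (AltTree.innerWeight (x ω) (fun k => y k ω) k j : ℂ) ^ 2 * H (k, j) ω)))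
          P P') ∧
      (∀ (ζ : Ω' → ℕ → ℝ) (H : ℕ → Ω' → ℂ),
        HasLaw ζ (AltTree.pdLaw α) P' → AltTree.IsIIDCopies H P' (h false) P →
        IndepFun ζ (fun ω k => H k ω) P' →
        IdentDistrib (h true)
          (fun ω => AltTree.psi η (∑' k, (ζ ω k : ℂ) ^ 2 * H k ω)) P P')) := by
  have hF := hξ.hasLaw_fieldLaw
  have hres : ∀ s, IdentDistrib (h s) (AltTree.hRes s η z) P (AltTree.fieldLaw α) := fun s => by
    subst h_def
    exact AltTree.identDistrib_of_hasLaw hF (AltTree.aemeasurable_hRes hα hη s z)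
  have hbar' : ∀ s, IdentDistrib (hbar s) (AltTree.hBar s η z) P (AltTree.fieldLaw α) :=
    fun s => by
      subst hbar_def
      exact AltTree.identDistrib_of_hasLaw hF (AltTree.aemeasurable_hBar hα hη s z)
  have hreg := AltTree.ae_of_hasLaw hF (AltTree.ae_isRegular hα)
  refine ⟨fun s => ?_, ?_, fun bm bp hbm hbp hind => ⟨?_, ?_, ?_⟩, fun ζ H hζ hH hind => ?_,
    fun x y b H hx hy hy' hb hH h1 h2 h3 => ?_, fun b ζ H hb hζ hH h1 h2 => ?_, fun hz => ?_⟩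
  · filter_upwards [hreg] with ω hω
    exact ⟨(hω.isDeterminate_hatTree s z).isSelfAdjointAdjacency,
      (hω.isDeterminate_barTree s z).isSelfAdjointAdjacency⟩
  · filter_upwards [AltTree.ae_hasDecay hα.1] with x hx using hx.summable hα
  · exact (AltTree.hRes_identDistrib_div hα hη false (hbm.trans (hbar' false))
      (hbp.trans (hbar' true)) hind).1
  · exact (hres false).trans (AltTree.hRes_identDistrib_div hα hη false
      (hbm.trans (hbar' false)) (hbp.trans (hbar' true)) hind).2
  · have h := (AltTree.hRes_identDistrib_div hα hη true (hbp.trans (hbar' true))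
      (hbm.trans (hbar' false)) hind.symm).2
    -- The lemma puts the entry of the tree in question first; both denominators in the statement
    -- have `bm` first.
    simp only [mul_right_comm _ (bp _) (bm _)] at h
    exact (hres true).trans h
  · have h := AltTree.hBar_true_identDistrib hα hη hζ
      ⟨hH.indep, fun i => (hH.identDistrib i).trans (hres false)⟩ hind
    exact ⟨h.1, (hbar' true).trans h.2⟩
  · have h := AltTree.hBar_false_identDistrib hα hη (AltTree.aemeasurable_hBar hα hη false z)
      (fun _ _ => rfl) hx hy hy'
      ⟨hb.indep, fun i => (hb.identDistrib i).trans (hbar' false)⟩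
      ⟨hH.indep, fun i => (hH.identDistrib i).trans (hres false)⟩ h1 h2 h3
    exact ⟨h.1, (hbar' false).trans h.2⟩
  · have h := AltTree.hBar_true_identDistrib hα hη hζ
      ⟨hH.indep, fun i => (hH.identDistrib i).trans (hres false)⟩ h2
    -- The expression in `ζ` and `H` is itself a copy of `hbar true` independent of `b`, so it can
    -- serve as the second factor in the quotient formula.
    have h' := AltTree.hRes_identDistrib_div hα hη false (hb.trans (hbar' false)) h.2.symm
      (h1.comp measurable_id (AltTree.measurable_plusMap η))
    exact ⟨h.1.and h'.1, (hres false).trans h'.2⟩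
  · subst hz
    have heq : ∀ s, hbar s =ᵐ[P] h s := fun s => by
      subst h_def hbar_def
      filter_upwards [hreg] with ω hω using hω.hBar_zero_eq hη s
    refine ⟨heq, fun x y H hx hy hy' hH h1 h2 => ?_, fun ζ H hζ hH hind => ?_⟩
    · have h := AltTree.hRes_false_zero_identDistrib hα hη hx hy hy'
        ⟨hH.indep, fun i => (hH.identDistrib i).trans (hres false)⟩ h1 h2
      exact ⟨h.1, (hres false).trans h.2⟩
    · have h := AltTree.hBar_true_identDistrib hα hη hζ
        ⟨hH.indep, fun i => (hH.identDistrib i).trans (hres false)⟩ hind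
      exact (IdentDistrib.of_ae_eq (hres true).aemeasurable_fst (heq true).symm).trans
        ((hbar' true).trans h.2)
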